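/- Let $d\ge 2$ and $0<s<\frac d2$; all functions below are real-valued on $\mathbb R^d$. Let $$\mathring H^s(\mathbb R^d)=\Big\{u\in L^{\frac{2d}{d-2s}}(\mathbb R^d):\ \widehat u \text{ is a function and } \|u\|_{\mathring H^s}^2:=\int_{\mathbb R^d}|\xi|^{2s}|\widehat u(\xi)|^2\,d\xi<\infty\Big\},$$ where $\widehat u$ is the Fourier transform of $u$ as a tempered distribution, and let $\mathring H^{-s}(\mathbb R^d)$ be the dual space of $\mathring H^s(\mathbb R^d)$, with duality pairing $\langle\cdot,\cdot\rangle$. For $q\in[1,\infty]$, $T\in\mathring H^{-s}(\mathbb R^d)\cap L^q_{loc}(\mathbb R^d)$ means that $T$ is a function in $L^q(K)$ for every compact set $K\subset\mathbb R^d$, together with a continuous linear functional on $\mathring H^s(\mathbb R^d)$, also denoted by $T$, such that $\langle T,\varphi\rangle=\int_{\mathbb R^d}T(x)\varphi(x)\,dx$ for all $\varphi\in C_c^\infty(\mathbb R^d)$. **Theorem.** Let $T\in \mathring H^{-s}(\mathbb R^d)\cap L^q_{loc}(\mathbb R^d)$ with $\frac{2d}{d+2s}\le q\le\infty$, and let $u\in\mathring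 H^s(\mathbb R^d)$ be such that $T(x)u(x)\ge -|f(x)|$ for almost every $x\in\mathbb R^d$, for some $f\in L^1(\mathbb R^d)$. Then $Tu\in L^1(\mathbb R^d)$ and $$\langle T,u\rangle=\int_{\mathbb R^d}T(x)u(x)\,dx .$$ -/

import Mathlib

open MeasureTheory
open scoped ENNReal ContDiff SchwartzMap FourierTransform

/-- The Euclidean space `ℝᵈ`. -/
abbrev Eucl (d : ℕ) : Type := EuclideanSpace ℝ (Fin d)

/-- The critical Sobolev exponent `2d / (d - 2s)`. -/
noncomputable def sobolevExponent (d : ℕ) (s : ℝ) : ℝ≥0∞ :=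
  ENNReal.ofReal (2 * d / (d - 2 * s))

/-- The function `g` is the Fourier transform of the (real-valued) function `u`, in the sense of
tempered distributions: `g` defines a tempered distribution, and `⟨u, 𝓕 φ⟩ = ⟨g, φ⟩` for every
Schwartz function `φ`. (Fourier transforms are normalised as in Mathlib,
`𝓕 φ ξ = ∫ exp (-2πi x·ξ) φ x dx`.) -/
structure IsFourierTransformOf {d : ℕ} (u : Eucl d → ℝ) (g : Eucl d → ℂ) : Prop where
  aestronglyMeasurable : AEStronglyMeasurable g volume
  integrable_mul : ∀ φ : 𝓢(Eucl d, ℂ), Integrable (fun ξ => g ξ * φ ξ) volume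
  integral_eq : ∀ φ : 𝓢(Eucl d, ℂ), ∫ x, (u x : ℂ) * (𝓕 φ) x = ∫ ξ, g ξ * φ ξ

namespace IsFourierTransformOf

variable {d : ℕ} {u v : Eucl d → ℝ} {g h : Eucl d → ℂ}

theorem locallyIntegrable (hg : IsFourierTransformOf u g) : LocallyIntegrable g volume := by
  rw [locallyIntegrable_iff]
  intro K hK
  obtain ⟨r, hr⟩ := hK.isBounded.subset_closedBall (0 : Eucl d)
  let b : ContDiffBump (0 : Eucl d) := ⟨max r 1, max r 1 + 1, by positivity, by linarith⟩
  have hbc : HasCompactSupport (fun x => ((b x : ℝ) : ℂ)) :=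
    b.hasCompactSupport.comp_left (g := fun t : ℝ => (t : ℂ)) (by simp)
  have hbs : ContDiff ℝ ∞ (fun x => ((b x : ℝ) : ℂ)) :=
    Complex.ofRealCLM.contDiff.comp b.contDiff
  have key := (hg.integrable_mul (hbc.toSchwartzMap hbs)).integrableOn (s := K)
  refine key.congr_fun (fun x hx => ?_) hK.measurableSet
  have : b x = 1 := b.one_of_mem_closedBall
    (Metric.closedBall_subset_closedBall (le_max_left _ _) (hr hx))
  simp [this]

theorem ae_eq (hg : IsFourierTransformOf u g) (hh : IsFourierTransformOf v h) (huv : u =ᵐ[volume] v) :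
    g =ᵐ[volume] h := by
  refine ae_eq_of_integral_contDiff_smul_eq hg.locallyIntegrable hh.locallyIntegrable ?_
  intro φ hφ hc
  have hbc : HasCompactSupport (fun x => ((φ x : ℝ) : ℂ)) :=
    hc.comp_left (g := fun t : ℝ => (t : ℂ)) (by simp)
  have hbs : ContDiff ℝ ∞ (fun x => ((φ x : ℝ) : ℂ)) := Complex.ofRealCLM.contDiff.comp hφ
  have e1 := hg.integral_eq (hbc.toSchwartzMap hbs)
  have e2 := hh.integral_eq (hbc.toSchwartzMap hbs)
  have e3 : ∫ x, (u x : ℂ) * (𝓕 (hbc.toSchwartzMap hbs)) x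
      = ∫ x, (v x : ℂ) * (𝓕 (hbc.toSchwartzMap hbs)) x :=
    integral_congr_ae (huv.mono fun x hx => by simp [hx])
  rw [e1, e2] at e3
  simpa [mul_comm] using e3

theorem congr_ae (hg : IsFourierTransformOf u g) (huv : u =ᵐ[volume] v) :
    IsFourierTransformOf v g where
  aestronglyMeasurable := hg.aestronglyMeasurable
  integrable_mul := hg.integrable_mul
  integral_eq φ := by
    rw [← hg.integral_eq φ]
    exact integral_congr_ae (huv.mono fun x hx => by simp [hx])

theorem integrable_mul_schwartz {p : ℝ≥0∞} (hp : 1 ≤ p) (hu : MemLp u p volume)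
    (φ : 𝓢(Eucl d, ℂ)) : Integrable (fun x => (u x : ℂ) * φ x) volume := by
  have : p.HolderConjugate p.conjExponent := ENNReal.HolderConjugate.conjExponent hp
  exact hu.ofReal.integrable_mul (φ.memLp p.conjExponent volume)

theorem add {p : ℝ≥0∞} (hp : 1 ≤ p) (hu : MemLp u p volume) (hv : MemLp v p volume)
    (hg : IsFourierTransformOf u g) (hh : IsFourierTransformOf v h) :
    IsFourierTransformOf (u + v) (g + h) where
  aestronglyMeasurable := hg.aestronglyMeasurable.add hh.aestronglyMeasurable
  integrable_mul φ := by
    simpa [add_mul] using! (hg.integrable_mul φ).add (hh.integrable_mul φ)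
  integral_eq φ := by
    simp only [Pi.add_apply, Complex.ofReal_add, add_mul]
    rw [integral_add (integrable_mul_schwartz hp hu _) (integrable_mul_schwartz hp hv _),
      integral_add (hg.integrable_mul φ) (hh.integrable_mul φ), hg.integral_eq, hh.integral_eq]

theorem smul (c : ℝ) (hg : IsFourierTransformOf u g) :
    IsFourierTransformOf (c • u) (c • g) where
  aestronglyMeasurable := hg.aestronglyMeasurable.const_smul c
  integrable_mul φ := by
    simpa [mul_assoc] using! (hg.integrable_mul φ).const_mul (c : ℂ)
  integral_eq φ := by
    simp only [Pi.smul_apply, smul_eq_mul, Complex.ofReal_mul, Complex.real_smul, mul_assoc]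
    rw [integral_const_mul, integral_const_mul, hg.integral_eq]

theorem zero : IsFourierTransformOf (0 : Eucl d → ℝ) 0 where
  aestronglyMeasurable := aestronglyMeasurable_zero
  integrable_mul φ := by simp
  integral_eq φ := by simp

theorem ae_eq_zero {p : ℝ≥0∞} (hp : 1 ≤ p) (hu : MemLp u p volume)
    (hg : IsFourierTransformOf u g) (h0 : g =ᵐ[volume] 0) : u =ᵐ[volume] 0 := by
  refine ae_eq_zero_of_integral_contDiff_smul_eq_zero (hu.locallyIntegrable hp) ?_
  intro φ hφ hc
  have hbc : HasCompactSupport (fun x => ((φ x : ℝ) : ℂ)) :=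
    hc.comp_left (g := fun t : ℝ => (t : ℂ)) (by simp)
  have hbs : ContDiff ℝ ∞ (fun x => ((φ x : ℝ) : ℂ)) := Complex.ofRealCLM.contDiff.comp hφ
  have e1 := hg.integral_eq (𝓕⁻ (hbc.toSchwartzMap hbs))
  have e2 : ∫ ξ, g ξ * (𝓕⁻ (hbc.toSchwartzMap hbs)) ξ = 0 := by
    rw [← integral_zero (Eucl d) ℂ]
    exact integral_congr_ae (h0.mono fun x hx => by simp [hx])
  rw [e2, FourierTransform.fourier_fourierInv_eq] at e1
  have e3 : ∫ x, (u x : ℂ) * (hbc.toSchwartzMap hbs) x = ((∫ x, φ x • u x : ℝ) : ℂ) := by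
    rw [← integral_complex_ofReal]
    exact integral_congr_ae (Filter.Eventually.of_forall fun x => by simp [mul_comm])
  rw [e3] at e1
  exact_mod_cast e1

end IsFourierTransformOf

theorem one_le_sobolevExponent (d : ℕ) (s : ℝ) (hs : 0 < s ∧ s < (d : ℝ) / 2) :
    1 ≤ sobolevExponent d s := by
  obtain ⟨h0, h1⟩ := hs
  rw [sobolevExponent, ENNReal.one_le_ofReal, le_div_iff₀ (by linarith)]
  linarith

theorem norm_weight_sq {d : ℕ} (s : ℝ) (ξ : Eucl d) (z : ℂ) :
    ‖(‖ξ‖ ^ s : ℝ) • z‖ ^ 2 = ‖ξ‖ ^ (2 * s) * ‖z‖ ^ 2 := by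
  rw [norm_smul, mul_pow, Real.norm_of_nonneg (by positivity), ← Real.rpow_natCast,
    ← Real.rpow_mul (norm_nonneg ξ)]
  congr 2
  push_cast
  ring

section HomSobolev

variable (d : ℕ) (s : ℝ) [hs : Fact (0 < s ∧ s < (d : ℝ) / 2)]

/-- The real-valued functions `u ∈ L^{2d/(d-2s)}(ℝᵈ)` whose Fourier transform `û` is a function
with `∫ |ξ|^{2s} |û(ξ)|² dξ < ∞`. -/
def homSobolevSubmodule : Submodule ℝ (Lp ℝ (sobolevExponent d s) (volume : Measure (Eucl d))) where
  carrier := {u | ∃ g : Eucl d → ℂ, IsFourierTransformOf u g ∧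
    Integrable (fun ξ => ‖ξ‖ ^ (2 * s) * ‖g ξ‖ ^ 2) volume}
  add_mem' := by
    rintro u v ⟨g, hg, hgi⟩ ⟨h, hh, hhi⟩
    refine ⟨g + h, ((hg.add (one_le_sobolevExponent d s hs.out) (Lp.memLp u) (Lp.memLp v)
      hh)).congr_ae (Lp.coeFn_add u v).symm, ?_⟩
    have hm : Measurable fun ξ : Eucl d => ‖ξ‖ ^ (2 * s) := by fun_prop
    refine ((hgi.add hhi).const_mul 2).mono' (hm.aestronglyMeasurable.mul
      ((hg.aestronglyMeasurable.add hh.aestronglyMeasurable).norm.pow 2)) ?_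
    refine Filter.Eventually.of_forall fun ξ => ?_
    have h1 : 0 ≤ ‖ξ‖ ^ (2 * s) := by positivity
    have h2 : ‖g ξ + h ξ‖ ^ 2 ≤ 2 * (‖g ξ‖ ^ 2 + ‖h ξ‖ ^ 2) := by
      nlinarith [norm_add_le (g ξ) (h ξ), sq_nonneg (‖g ξ‖ - ‖h ξ‖), norm_nonneg (g ξ + h ξ),
        norm_nonneg (g ξ), norm_nonneg (h ξ)]
    simp only [Pi.add_apply]
    rw [Real.norm_of_nonneg (by positivity)]
    nlinarith [mul_le_mul_of_nonneg_left h2 h1]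
  zero_mem' := by
    refine ⟨0, IsFourierTransformOf.zero.congr_ae (Lp.coeFn_zero ℝ _ volume).symm, ?_⟩
    simp
  smul_mem' := by
    rintro c u ⟨g, hg, hgi⟩
    refine ⟨c • g, (hg.smul c).congr_ae (Lp.coeFn_smul c u).symm, ?_⟩
    refine (hgi.const_mul (c ^ 2)).congr (Filter.Eventually.of_forall fun ξ => ?_)
    simp only [Pi.smul_apply, norm_smul, mul_pow, Real.norm_eq_abs, sq_abs]
    ring

/-- The homogeneous fractional Sobolev space `H̊ˢ(ℝᵈ)`, for `0 < s < d / 2`. It is a type of its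
own because it carries the norm `(∫ |ξ|^{2s} |û(ξ)|² dξ)^{1/2}` and not the Lebesgue norm. -/
def HomSobolev : Type := homSobolevSubmodule d s

namespace HomSobolev

noncomputable instance : AddCommGroup (HomSobolev d s) :=
  inferInstanceAs (AddCommGroup (homSobolevSubmodule d s))

noncomputable instance : Module ℝ (HomSobolev d s) :=
  inferInstanceAs (Module ℝ (homSobolevSubmodule d s))

variable {d s}

/-- The underlying element of `L^{2d/(d-2s)}(ℝᵈ)`. -/
def toLp (u : HomSobolev d s) : Lp ℝ (sobolevExponent d s) (volume : Measure (Eucl d)) := u.1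

noncomputable instance : CoeFun (HomSobolev d s) fun _ => Eucl d → ℝ :=
  ⟨fun u => (u.toLp : Eucl d → ℝ)⟩

/-- The Fourier transform `û` of `u ∈ H̊ˢ(ℝᵈ)`, a function unique up to null sets. -/
noncomputable def fourier (u : HomSobolev d s) : Eucl d → ℂ := u.2.choose

noncomputable instance : Norm (HomSobolev d s) :=
  ⟨fun u => Real.sqrt (∫ ξ, ‖ξ‖ ^ (2 * s) * ‖u.fourier ξ‖ ^ 2)⟩

theorem norm_def (u : HomSobolev d s) :
    ‖u‖ = Real.sqrt (∫ ξ, ‖ξ‖ ^ (2 * s) * ‖u.fourier ξ‖ ^ 2) := rfl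

theorem isFourierTransformOf_fourier (u : HomSobolev d s) : IsFourierTransformOf u u.fourier :=
  u.2.choose_spec.1

theorem integrable_fourier (u : HomSobolev d s) :
    Integrable (fun ξ => ‖ξ‖ ^ (2 * s) * ‖u.fourier ξ‖ ^ 2) volume :=
  u.2.choose_spec.2

theorem memLp (u : HomSobolev d s) : MemLp u (sobolevExponent d s) volume := Lp.memLp _

theorem coe_add (u v : HomSobolev d s) : ⇑(u + v) =ᵐ[volume] u + v := Lp.coeFn_add u.toLp v.toLp

theorem coe_smul (c : ℝ) (u : HomSobolev d s) : ⇑(c • u) =ᵐ[volume] c • u :=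
  Lp.coeFn_smul c u.toLp

theorem fourier_add (u v : HomSobolev d s) :
    (u + v).fourier =ᵐ[volume] u.fourier + v.fourier :=
  (u + v).isFourierTransformOf_fourier.ae_eq
    (u.isFourierTransformOf_fourier.add (one_le_sobolevExponent d s hs.out) u.memLp v.memLp
      v.isFourierTransformOf_fourier) (coe_add u v)

theorem fourier_smul (c : ℝ) (u : HomSobolev d s) :
    (c • u).fourier =ᵐ[volume] c • u.fourier :=
  (c • u).isFourierTransformOf_fourier.ae_eq (u.isFourierTransformOf_fourier.smul c) (coe_smul c u)

theorem memLp_weight (u : HomSobolev d s) :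
    MemLp (fun ξ => (‖ξ‖ ^ s : ℝ) • u.fourier ξ) 2 volume := by
  have hm : Measurable fun ξ : Eucl d => ‖ξ‖ ^ s := by fun_prop
  refine (memLp_two_iff_integrable_sq_norm
    (hm.aestronglyMeasurable.smul u.isFourierTransformOf_fourier.aestronglyMeasurable)).2 ?_
  simpa only [Pi.smul_apply', norm_weight_sq] using u.integrable_fourier

theorem norm_eq_toLp (u : HomSobolev d s) : ‖u‖ = ‖u.memLp_weight.toLp‖ := by
  rw [norm_def, Lp.norm_toLp, u.memLp_weight.eLpNorm_eq_integral_rpow_norm (by simp) (by simp),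
    ENNReal.toReal_ofReal (by positivity), Real.sqrt_eq_rpow]
  simp only [ENNReal.toReal_ofNat, Real.rpow_ofNat, norm_weight_sq, one_div]

theorem normedSpaceCore : NormedSpace.Core ℝ (HomSobolev d s) where
  norm_nonneg u := Real.sqrt_nonneg _
  norm_smul c u := by
    have h : (c • u).memLp_weight.toLp = c • u.memLp_weight.toLp := by
      rw [← MemLp.toLp_const_smul]
      refine (MemLp.toLp_eq_toLp_iff _ _).2 ((fourier_smul c u).mono fun ξ hξ => ?_)
      simp only [hξ, Pi.smul_apply]
      rw [smul_comm]
    rw [norm_eq_toLp, norm_eq_toLp, h, norm_smul]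
  norm_triangle u v := by
    have h : (u + v).memLp_weight.toLp = u.memLp_weight.toLp + v.memLp_weight.toLp := by
      rw [← MemLp.toLp_add]
      refine (MemLp.toLp_eq_toLp_iff _ _).2 ((fourier_add u v).mono fun ξ hξ => ?_)
      simp only [hξ, Pi.add_apply, smul_add]
    rw [norm_eq_toLp, norm_eq_toLp, norm_eq_toLp, h]
    exact norm_add_le _ _
  norm_eq_zero_iff u := by
    constructor
    · intro h
      rw [norm_eq_toLp, norm_eq_zero, Lp.eq_zero_iff_ae_eq_zero] at h
      replace h := u.memLp_weight.coeFn_toLp.symm.trans h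
      have hd : Nonempty (Fin d) := by
        refine ⟨⟨0, Nat.pos_of_ne_zero ?_⟩⟩
        rintro rfl
        have := hs.out
        norm_num at this
        linarith
      have hg : u.fourier =ᵐ[volume] 0 := by
        filter_upwards [h, compl_mem_ae_iff.2 (measure_singleton (0 : Eucl d))] with ξ hξ h0
        have : ‖ξ‖ ^ s ≠ 0 := (Real.rpow_pos_of_pos (norm_pos_iff.2 h0) s).ne'
        simpa [this] using hξ
      have hu := u.isFourierTransformOf_fourier.ae_eq_zero
        (one_le_sobolevExponent d s hs.out) u.memLp hg
      exact Subtype.ext ((Lp.eq_zero_iff_ae_eq_zero).2 hu)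
    · rintro rfl
      have h := fourier_smul (0 : ℝ) (0 : HomSobolev d s)
      rw [zero_smul, zero_smul] at h
      rw [norm_eq_toLp, norm_eq_zero, Lp.eq_zero_iff_ae_eq_zero]
      refine (MemLp.coeFn_toLp _).trans (h.mono fun ξ hξ => by simp [hξ])

noncomputable instance : NormedAddCommGroup (HomSobolev d s) :=
  NormedAddCommGroup.ofCore normedSpaceCore

noncomputable instance : NormedSpace ℝ (HomSobolev d s) :=
  NormedSpace.ofCore normedSpaceCore

/-- A test function `φ ∈ C_c^∞(ℝᵈ)`, seen as an element of `H̊ˢ(ℝᵈ)`. -/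
noncomputable def ofTestFunction (φ : Eucl d → ℝ) (hφ : ContDiff ℝ ∞ φ)
    (hc : HasCompactSupport φ) : HomSobolev d s :=
  ⟨((hc.toSchwartzMap hφ).memLp (sobolevExponent d s) volume).toLp, by
    have hbc : HasCompactSupport (fun x => ((φ x : ℝ) : ℂ)) :=
      hc.comp_left (g := fun t : ℝ => (t : ℂ)) (by simp)
    have hbs : ContDiff ℝ ∞ (fun x => ((φ x : ℝ) : ℂ)) := Complex.ofRealCLM.contDiff.comp hφ
    let ψ : 𝓢(Eucl d, ℂ) := 𝓕 (hbc.toSchwartzMap hbs)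
    refine ⟨ψ, IsFourierTransformOf.congr_ae (u := φ) ⟨ψ.continuous.aestronglyMeasurable, ?_, ?_⟩
      (MemLp.coeFn_toLp _).symm, ?_⟩
    · intro f
      exact (ψ.memLp 2 volume).integrable_mul (f.memLp 2 volume)
    · intro f
      have := SchwartzMap.integral_fourier_mul_eq (hbc.toSchwartzMap hbs) f
      simpa using this.symm
    · have hm : Measurable fun ξ : Eucl d => ‖ξ‖ ^ (2 * s) := by fun_prop
      obtain ⟨k, hk⟩ := exists_nat_ge (2 * s)
      obtain ⟨C, hC⟩ : ∃ C, ∀ ξ, ‖ψ ξ‖ ≤ C :=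
        ⟨_, fun ξ => SchwartzMap.norm_le_seminorm ℝ ψ ξ⟩
      refine (((ψ.integrable.norm).add (ψ.integrable_pow_mul volume k)).const_mul C).mono'
        (hm.aestronglyMeasurable.mul (ψ.continuous.aestronglyMeasurable.norm.pow 2)) ?_
      refine Filter.Eventually.of_forall fun ξ => ?_
      have h1 : ‖ξ‖ ^ (2 * s) ≤ 1 + ‖ξ‖ ^ k := by
        rcases le_total ‖ξ‖ 1 with h | h
        · have := Real.rpow_le_one (norm_nonneg ξ) h (z := 2 * s) (by linarith [hs.out.1])
          have : 0 ≤ ‖ξ‖ ^ k := by positivity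
          linarith
        · have := Real.rpow_le_rpow_of_exponent_le h hk
          rw [Real.rpow_natCast] at this
          linarith
      have h2 : 0 ≤ ‖ξ‖ ^ (2 * s) := by positivity
      have h3 := hC ξ
      have h4 := norm_nonneg (ψ ξ)
      rw [Real.norm_of_nonneg (by positivity)]
      simp only [Pi.add_apply]
      calc ‖ξ‖ ^ (2 * s) * ‖ψ ξ‖ ^ 2 ≤ (1 + ‖ξ‖ ^ k) * (C * ‖ψ ξ‖) := by
            gcongr
            nlinarith
        _ = C * (‖ψ ξ‖ + ‖ξ‖ ^ k * ‖ψ ξ‖) := by ring⟩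

theorem coe_ofTestFunction (φ : Eucl d → ℝ) (hφ : ContDiff ℝ ∞ φ) (hc : HasCompactSupport φ) :
    ⇑(ofTestFunction φ hφ hc : HomSobolev d s) =ᵐ[volume] φ :=
  MemLp.coeFn_toLp ((hc.toSchwartzMap hφ).memLp (sobolevExponent d s) volume)

end HomSobolev

/-- The dual space `H̊⁻ˢ(ℝᵈ)` of the normed space `H̊ˢ(ℝᵈ)`; the duality pairing `⟨Λ, u⟩` is the
evaluation `Λ u`. -/
abbrev HomSobolevDual : Type := StrongDual ℝ (HomSobolev d s)

end HomSobolev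

/-- `T ∈ L^q_loc(ℝᵈ)`: the function `T` is in `L^q(K)` for every compact set `K`. -/
def MemLpLocally {d : ℕ} (T : Eucl d → ℝ) (q : ℝ≥0∞) : Prop :=
  ∀ K : Set (Eucl d), IsCompact K → MemLp T q (volume.restrict K)

/-- The functional `Λ ∈ H̊⁻ˢ(ℝᵈ)` is the regular distribution given by the function `T`:
`⟨Λ, φ⟩ = ∫ T φ` for every test function `φ ∈ C_c^∞(ℝᵈ)`. -/
def HomSobolevDual.IsRegular {d : ℕ} {s : ℝ} [Fact (0 < s ∧ s < (d : ℝ) / 2)]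
    (Λ : HomSobolevDual d s) (T : Eucl d → ℝ) : Prop :=
  ∀ (φ : Eucl d → ℝ) (hφ : ContDiff ℝ ∞ φ) (hc : HasCompactSupport φ),
    Λ (HomSobolev.ofTestFunction φ hφ hc) = ∫ x, T x * φ x

/-
Multiplication by the cutoffs `χ (x / R)` is bounded on `H̊ˢ` uniformly in `R`, because the norm is
homogeneous under dilations. A bounded family in `H̊ˢ` that converges as distributions converges
weakly, so `⟨T, χ (· / R) u⟩ → ⟨T, u⟩`. On compactly supported elements the pairing is integration,
by mollification, which does not increase the `H̊ˢ` norm. Hence the integrals of `χ (x / R) T u` are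
bounded, Fatou's lemma applied to `χ (x / R) (T u + |f|)` gives `T u ∈ L¹`, and dominated
convergence identifies the limit.
-/

open Filter Topology

section Young

theorem lintegral_mul_rpow_le {α : Type*} [MeasurableSpace α] {μ : Measure α} {p : ℝ}
    (hp : 1 ≤ p) {k f : α → ℝ≥0∞} (hk : AEMeasurable k μ) (hf : AEMeasurable f μ) :
    (∫⁻ x, k x * f x ∂μ) ^ p ≤ (∫⁻ x, k x ∂μ) ^ (p - 1) * ∫⁻ x, k x * f x ^ p ∂μ := by
  have hp0 : 0 < p := zero_lt_one.trans_le hp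
  have holder := eLpNorm'_le_eLpNorm'_mul_rpow_measure_univ (μ := μ.withDensity k) one_pos hp
    (hf.mono_ac (withDensity_absolutelyContinuous μ k)).aestronglyMeasurable
  simp only [eLpNorm', enorm_eq_self, ENNReal.rpow_one, div_one,
    withDensity_apply _ MeasurableSet.univ, Measure.restrict_univ] at holder
  rw [lintegral_withDensity_eq_lintegral_mul₀ hk hf,
    lintegral_withDensity_eq_lintegral_mul₀ hk (hf.pow_const p)] at holder
  calc (∫⁻ x, k x * f x ∂μ) ^ p
      ≤ ((∫⁻ x, k x * f x ^ p ∂μ) ^ (1 / p) * (∫⁻ x, k x ∂μ) ^ (1 - 1 / p)) ^ p := by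
        gcongr
        simpa using holder
    _ = (∫⁻ x, k x ∂μ) ^ (p - 1) * ∫⁻ x, k x * f x ^ p ∂μ := by
        rw [ENNReal.mul_rpow_of_nonneg _ _ hp0.le, ← ENNReal.rpow_mul, ← ENNReal.rpow_mul,
          one_div_mul_cancel hp0.ne', ENNReal.rpow_one, sub_mul, one_div_mul_cancel hp0.ne',
          one_mul, mul_comm]

variable {G : Type*} [AddGroup G] [MeasurableSpace G] [MeasurableAdd₂ G] [MeasurableNeg G]
  {μ : Measure G} [SFinite μ] [μ.IsAddLeftInvariant]

theorem lintegral_lconvolution {k f : G → ℝ≥0∞} (hk : AEMeasurable k μ) (hf : AEMeasurable f μ) :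
    ∫⁻ x, (k ⋆ₗ[μ] f) x ∂μ = (∫⁻ x, k x ∂μ) * ∫⁻ x, f x ∂μ := by
  simp only [lconvolution_def]
  rw [lintegral_lintegral_swap (by fun_prop), ← lintegral_mul_const'' _ hk]
  refine lintegral_congr fun y => ?_
  have hfy : AEMeasurable (fun x => f (-y + x)) μ :=
    hf.comp_quasiMeasurePreserving (measurePreserving_add_left μ (-y)).quasiMeasurePreserving
  rw [lintegral_const_mul'' _ hfy, lintegral_add_left_eq_self f (-y)]

theorem lintegral_lconvolution_rpow_le {p : ℝ} (hp : 1 ≤ p) {k f : G → ℝ≥0∞}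
    (hk : AEMeasurable k μ) (hf : AEMeasurable f μ) :
    ∫⁻ x, (k ⋆ₗ[μ] f) x ^ p ∂μ ≤ (∫⁻ x, k x ∂μ) ^ p * ∫⁻ x, f x ^ p ∂μ := by
  calc ∫⁻ x, (k ⋆ₗ[μ] f) x ^ p ∂μ
      ≤ ∫⁻ x, (∫⁻ y, k y ∂μ) ^ (p - 1) * (k ⋆ₗ[μ] fun y => f y ^ p) x ∂μ :=
        lintegral_mono fun x => lintegral_mul_rpow_le hp hk (by fun_prop)
    _ = (∫⁻ y, k y ∂μ) ^ (p - 1) * ((∫⁻ y, k y ∂μ) * ∫⁻ x, f x ^ p ∂μ) := by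
        rw [lintegral_const_mul'' _ (by fun_prop), lintegral_lconvolution hk (by fun_prop)]
    _ = (∫⁻ y, k y ∂μ) ^ p * ∫⁻ x, f x ^ p ∂μ := by
        rw [← mul_assoc]
        nth_rw 2 [← ENNReal.rpow_one (∫⁻ y, k y ∂μ)]
        rw [← ENNReal.rpow_add_of_nonneg _ _ (sub_nonneg.2 hp) zero_le_one, sub_add_cancel]

theorem lintegral_lconvolution_sq_le {k f : G → ℝ≥0∞} (hk : AEMeasurable k μ)
    (hf : AEMeasurable f μ) :
    ∫⁻ x, (k ⋆ₗ[μ] f) x ^ 2 ∂μ ≤ (∫⁻ x, k x ∂μ) ^ 2 * ∫⁻ x, f x ^ 2 ∂μ := by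
  simpa using lintegral_lconvolution_rpow_le one_le_two hk hf

end Young

section HomEnergy

theorem ennreal_add_sq_le (a b : ℝ≥0∞) : (a + b) ^ 2 ≤ 2 * (a ^ 2 + b ^ 2) := by
  simpa [show (2 : ℝ) - 1 = 1 by norm_num] using
    ENNReal.rpow_add_le_mul_rpow_add_rpow a b one_le_two

theorem enorm_rpow_le_two_rpow_mul {E : Type*} [NormedAddCommGroup E] (x y : E) {s : ℝ}
    (hs : 0 ≤ s) : ‖x‖ₑ ^ s ≤ 2 ^ s * (‖y‖ₑ ^ s + ‖-y + x‖ₑ ^ s) :=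
  calc ‖x‖ₑ ^ s ≤ (‖y‖ₑ + ‖-y + x‖ₑ) ^ s := by
        gcongr
        simpa using enorm_add_le y (-y + x)
    _ ≤ 2 ^ s * (‖y‖ₑ ^ s + ‖-y + x‖ₑ ^ s) :=
        ENNReal.add_rpow_le_two_rpow_mul_rpow_add_rpow _ _ hs

theorem one_le_enorm_of_notMem_ball {E : Type*} [SeminormedAddGroup E] {x : E}
    (hx : x ∉ Metric.ball (0 : E) 1) : 1 ≤ ‖x‖ₑ := by
  rw [← ofReal_norm, ENNReal.one_le_ofReal]
  simpa using hx

variable {E : Type*} [NormedAddCommGroup E] [MeasurableSpace E] {μ : Measure E}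

/-- The squared norm of `F` in the weighted space `L²(|ξ|^{2s} dμ)`. For the modulus `F` of the
Fourier transform of `u`, this is the squared norm of `u` in the homogeneous Sobolev space of
order `s`. -/
noncomputable def homEnergy (s : ℝ) (F : E → ℝ≥0∞) (μ : Measure E) : ℝ≥0∞ :=
  ∫⁻ ξ, (‖ξ‖ₑ ^ s * F ξ) ^ 2 ∂μ

theorem homEnergy_mono {s : ℝ} {F G : E → ℝ≥0∞} (h : ∀ ξ, F ξ ≤ G ξ) :
    homEnergy s F μ ≤ homEnergy s G μ := by
  refine lintegral_mono fun ξ => ?_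
  gcongr
  exact h ξ

theorem lintegral_indicator_compl_ball_sq_le_homEnergy {s : ℝ} (hs : 0 ≤ s) (G : E → ℝ≥0∞) :
    ∫⁻ ξ, (Metric.ball 0 1)ᶜ.indicator G ξ ^ 2 ∂μ ≤ homEnergy s G μ := by
  refine lintegral_mono fun ξ => ?_
  by_cases hξ : ξ ∈ Metric.ball (0 : E) 1
  · simp [hξ]
  · have hξ1 := one_le_enorm_of_notMem_ball hξ
    rw [Set.indicator_of_mem (by simpa using hξ)]
    gcongr
    exact le_mul_of_one_le_left' (by simpa using ENNReal.rpow_le_rpow hξ1 hs)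

theorem homEnergy_neg_le_of_le {s : ℝ} (hs : 0 ≤ s) {G : E → ℝ≥0∞} (hG : AEMeasurable G μ)
    {C : ℝ≥0∞} (hC : C ≠ ⊤) (hGC : ∀ ξ, G ξ ≤ C) :
    homEnergy (-s) G μ ≤
      C ^ 2 * homEnergy (-s) ((Metric.ball 0 1).indicator 1) μ + ∫⁻ ξ, G ξ ^ 2 ∂μ := by
  rw [homEnergy, homEnergy, ← lintegral_const_mul' _ _ (by finiteness),
    ← lintegral_add_right' _ (by fun_prop)]
  refine lintegral_mono fun ξ => ?_
  by_cases hξ : ξ ∈ Metric.ball (0 : E) 1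
  · rw [Set.indicator_of_mem hξ, Pi.one_apply, mul_one, mul_pow, mul_comm]
    exact (by gcongr; exact hGC ξ : _ ≤ C ^ 2 * (‖ξ‖ₑ ^ (-s)) ^ 2).trans le_self_add
  · have hξ1 := one_le_enorm_of_notMem_ball hξ
    refine le_trans ?_ le_add_self
    gcongr
    refine mul_le_of_le_one_left' ?_
    rw [ENNReal.rpow_neg, ENNReal.inv_le_one]
    simpa using ENNReal.rpow_le_rpow hξ1 hs

variable [BorelSpace E]

theorem sq_lintegral_mul_le_homEnergy_mul_homEnergy [NullSingletonClass μ] (s : ℝ)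
    {F H : E → ℝ≥0∞} (hF : AEMeasurable F μ) (hH : AEMeasurable H μ) :
    (∫⁻ ξ, F ξ * H ξ ∂μ) ^ 2 ≤ homEnergy (-s) F μ * homEnergy s H μ := by
  have hFH : ∫⁻ ξ, F ξ * H ξ ∂μ = ∫⁻ ξ, (‖ξ‖ₑ ^ (-s) * F ξ) * (‖ξ‖ₑ ^ s * H ξ) ∂μ := by
    refine lintegral_congr_ae ?_
    filter_upwards [compl_mem_ae_iff.2 (measure_singleton (0 : E))] with ξ hξ
    have hξ' : ‖ξ‖ₑ ^ (-s) * ‖ξ‖ₑ ^ s = 1 := by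
      rw [← ENNReal.rpow_add _ _ (by simpa using hξ) enorm_ne_top, neg_add_cancel,
        ENNReal.rpow_zero]
    rw [mul_mul_mul_comm, hξ', one_mul]
  have holder := ENNReal.lintegral_mul_le_Lp_mul_Lq μ Real.HolderConjugate.two_two
    (f := fun ξ => ‖ξ‖ₑ ^ (-s) * F ξ) (g := fun ξ => ‖ξ‖ₑ ^ s * H ξ) (by fun_prop) (by fun_prop)
  calc (∫⁻ ξ, F ξ * H ξ ∂μ) ^ 2
      ≤ (homEnergy (-s) F μ ^ (1 / 2 : ℝ) * homEnergy s H μ ^ (1 / 2 : ℝ)) ^ 2 := by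
        rw [hFH]
        gcongr
        simpa [homEnergy] using holder
    _ = homEnergy (-s) F μ * homEnergy s H μ := by
        simp [mul_pow, ← ENNReal.rpow_mul_natCast]

theorem sq_lintegral_indicator_ball_le_homEnergy [NullSingletonClass μ] (s : ℝ) {G : E → ℝ≥0∞}
    (hG : AEMeasurable G μ) :
    (∫⁻ ξ, (Metric.ball 0 1).indicator G ξ ∂μ) ^ 2
      ≤ homEnergy (-s) ((Metric.ball 0 1).indicator 1) μ * homEnergy s G μ := by
  convert! sq_lintegral_mul_le_homEnergy_mul_homEnergy s
    (measurable_one.indicator Metric.isOpen_ball.measurableSet).aemeasurable hG using 4 with ξ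
  by_cases hξ : ξ ∈ Metric.ball (0 : E) 1 <;> simp [hξ]

variable [SecondCountableTopology E] [SFinite μ] [μ.IsAddLeftInvariant]

theorem enorm_rpow_mul_lconvolution_le {s : ℝ} (hs : 0 ≤ s) {k G : E → ℝ≥0∞}
    (hk : AEMeasurable k μ) (hG : AEMeasurable G μ) (ξ : E) :
    ‖ξ‖ₑ ^ s * (k ⋆ₗ[μ] G) ξ ≤ 2 ^ s * (((fun x => ‖x‖ₑ ^ s * k x) ⋆ₗ[μ] G) ξ +
      (k ⋆ₗ[μ] fun x => ‖x‖ₑ ^ s * G x) ξ) := by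
  simp only [lconvolution_def]
  rw [← lintegral_const_mul'' _ (by fun_prop), ← lintegral_add_left' (by fun_prop),
    ← lintegral_const_mul'' _ (by fun_prop)]
  refine lintegral_mono fun y => ?_
  calc ‖ξ‖ₑ ^ s * (k y * G (-y + ξ))
      ≤ (2 ^ s * (‖y‖ₑ ^ s + ‖-y + ξ‖ₑ ^ s)) * (k y * G (-y + ξ)) := by
        gcongr
        exact enorm_rpow_le_two_rpow_mul ξ y hs
    _ = _ := by ring

theorem lintegral_lconvolution_sq_le_mul_homEnergy [NullSingletonClass μ] [μ.IsNegInvariant] {s : ℝ}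
    (hs : 0 ≤ s) {k G : E → ℝ≥0∞} (hk : AEMeasurable k μ) (hG : AEMeasurable G μ) :
    ∫⁻ ξ, (k ⋆ₗ[μ] G) ξ ^ 2 ∂μ ≤
      2 * (homEnergy (-s) ((Metric.ball 0 1).indicator 1) μ * (∫⁻ x, k x ^ 2 ∂μ) +
        (∫⁻ x, k x ∂μ) ^ 2) * homEnergy s G μ := by
  set B : Set E := Metric.ball 0 1
  have hB : MeasurableSet B := Metric.isOpen_ball.measurableSet
  have hGB : AEMeasurable (B.indicator G) μ := hG.indicator hB
  have hGB' : AEMeasurable (Bᶜ.indicator G) μ := hG.indicator hB.compl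
  have near : ∫⁻ ξ, (k ⋆ₗ[μ] B.indicator G) ξ ^ 2 ∂μ ≤
      homEnergy (-s) (B.indicator 1) μ * homEnergy s G μ * ∫⁻ x, k x ^ 2 ∂μ := by
    rw [lconvolution_comm]
    refine (lintegral_lconvolution_sq_le hGB hk).trans ?_
    gcongr
    exact sq_lintegral_indicator_ball_le_homEnergy s hG
  have far : ∫⁻ ξ, (k ⋆ₗ[μ] Bᶜ.indicator G) ξ ^ 2 ∂μ ≤
      (∫⁻ x, k x ∂μ) ^ 2 * homEnergy s G μ := by
    refine (lintegral_lconvolution_sq_le hk hGB').trans ?_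
    gcongr
    exact lintegral_indicator_compl_ball_sq_le_homEnergy hs G
  have split (ξ : E) :
      (k ⋆ₗ[μ] G) ξ = (k ⋆ₗ[μ] B.indicator G) ξ + (k ⋆ₗ[μ] Bᶜ.indicator G) ξ := by
    simp only [lconvolution_def]
    rw [← lintegral_add_left' (by fun_prop)]
    simp only [← mul_add, Set.indicator_self_add_compl_apply]
  calc ∫⁻ ξ, (k ⋆ₗ[μ] G) ξ ^ 2 ∂μ
      ≤ ∫⁻ ξ, 2 * ((k ⋆ₗ[μ] B.indicator G) ξ ^ 2 + (k ⋆ₗ[μ] Bᶜ.indicator G) ξ ^ 2) ∂μ := by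
        simp only [split]
        exact lintegral_mono fun ξ => ennreal_add_sq_le _ _
    _ = 2 * ((∫⁻ ξ, (k ⋆ₗ[μ] B.indicator G) ξ ^ 2 ∂μ) +
          ∫⁻ ξ, (k ⋆ₗ[μ] Bᶜ.indicator G) ξ ^ 2 ∂μ) := by
        rw [lintegral_const_mul'' _ (by fun_prop), lintegral_add_left' (by fun_prop)]
    _ ≤ 2 * (homEnergy (-s) (B.indicator 1) μ * homEnergy s G μ * (∫⁻ x, k x ^ 2 ∂μ) +
          (∫⁻ x, k x ∂μ) ^ 2 * homEnergy s G μ) := by gcongr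
    _ = _ := by ring

theorem homEnergy_lconvolution_le [NullSingletonClass μ] [μ.IsNegInvariant] {s : ℝ}
    (hs : 0 ≤ s) {k G : E → ℝ≥0∞} (hk : AEMeasurable k μ) (hG : AEMeasurable G μ) :
    homEnergy s (k ⋆ₗ[μ] G) μ ≤ (2 ^ s) ^ 2 * (2 *
      (2 * (homEnergy (-s) ((Metric.ball 0 1).indicator 1) μ * homEnergy s k μ +
        (∫⁻ x, ‖x‖ₑ ^ s * k x ∂μ) ^ 2) + (∫⁻ x, k x ∂μ) ^ 2)) * homEnergy s G μ := by
  set A := (fun x => ‖x‖ₑ ^ s * k x) ⋆ₗ[μ] G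
  set B := k ⋆ₗ[μ] fun x => ‖x‖ₑ ^ s * G x
  calc homEnergy s (k ⋆ₗ[μ] G) μ
      ≤ ∫⁻ ξ, (2 ^ s) ^ 2 * (2 * (A ξ ^ 2 + B ξ ^ 2)) ∂μ := by
        refine lintegral_mono fun ξ => ?_
        refine (pow_le_pow_left' (enorm_rpow_mul_lconvolution_le hs hk hG ξ) 2).trans ?_
        rw [mul_pow]
        gcongr
        exact ennreal_add_sq_le _ _
    _ = (2 ^ s) ^ 2 * (2 * ((∫⁻ ξ, A ξ ^ 2 ∂μ) + ∫⁻ ξ, B ξ ^ 2 ∂μ)) := by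
        rw [lintegral_const_mul'' _ (by fun_prop), lintegral_const_mul'' _ (by fun_prop),
          lintegral_add_left' (by fun_prop)]
    _ ≤ (2 ^ s) ^ 2 * (2 * (2 * (homEnergy (-s) ((Metric.ball 0 1).indicator 1) μ *
          homEnergy s k μ + (∫⁻ x, ‖x‖ₑ ^ s * k x ∂μ) ^ 2) * homEnergy s G μ +
          (∫⁻ x, k x ∂μ) ^ 2 * homEnergy s G μ)) := by
        gcongr
        · exact lintegral_lconvolution_sq_le_mul_homEnergy hs (by fun_prop) hG
        · exact lintegral_lconvolution_sq_le hk (by fun_prop)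
    _ = _ := by ring

end HomEnergy

section Dilation

variable {E : Type*} [NormedAddCommGroup E] [NormedSpace ℝ E] [FiniteDimensional ℝ E]
  [MeasurableSpace E] [BorelSpace E] {μ : Measure E} [μ.IsAddHaarMeasure]

theorem homEnergy_neg_indicator_ball_lt_top {s : ℝ} (hE : 0 < Module.finrank ℝ E)
    (hs : 2 * s < Module.finrank ℝ E) :
    homEnergy (-s) ((Metric.ball (0 : E) 1).indicator 1) μ < ⊤ := by
  have : Nontrivial E := Module.nontrivial_of_finrank_pos hE
  have hint := integrableOn_ball_of_norm_le_rpow (μ := μ) (r := 1)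
    (f := fun x : E => ‖x‖ ^ (-(2 * s))) (C := 1) hE hs
    (Eventually.of_forall fun x => by rw [one_mul, Real.norm_of_nonneg (by positivity)])
    (measurable_norm.pow_const _).aestronglyMeasurable
  refine lt_of_le_of_lt ?_ hint.2
  rw [homEnergy, ← lintegral_indicator Metric.isOpen_ball.measurableSet]
  refine lintegral_mono_ae ?_
  filter_upwards [compl_mem_ae_iff.2 (measure_singleton (0 : E))] with ξ hξ
  have hξ' : 0 < ‖ξ‖ := by simpa using hξ
  by_cases hξB : ξ ∈ Metric.ball (0 : E) 1
  · rw [Set.indicator_of_mem hξB, Set.indicator_of_mem hξB, Pi.one_apply, mul_one,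
      ← ENNReal.rpow_mul_natCast, ← ofReal_norm, ENNReal.ofReal_rpow_of_pos hξ',
      Real.enorm_of_nonneg (by positivity)]
    refine (congrArg _ ?_).le
    congr 1
    push_cast
    ring
  · simp [hξB]

theorem lintegral_comp_smul (f : E → ℝ≥0∞) {R : ℝ} (hR : R ≠ 0) :
    ∫⁻ x, f (R • x) ∂μ = ENNReal.ofReal |(R ^ Module.finrank ℝ E)⁻¹| * ∫⁻ x, f x ∂μ := by
  have map := lintegral_map_equiv (μ := μ) f
    (Homeomorph.smul (Units.mk0 R hR)).toMeasurableEquiv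
  have map_smul : μ.map (Homeomorph.smul (Units.mk0 R hR)).toMeasurableEquiv
      = ENNReal.ofReal |(R ^ Module.finrank ℝ E)⁻¹| • μ := Measure.map_addHaar_smul μ hR
  rw [map_smul, lintegral_smul_measure] at map
  exact map.symm

theorem homEnergy_comp_smul {s : ℝ} (hs : 0 ≤ s) (F : E → ℝ≥0∞) {R : ℝ} (hR : R ≠ 0) :
    homEnergy s (fun ξ => F (R • ξ)) μ =
      (‖R⁻¹‖ₑ ^ s) ^ 2 * ENNReal.ofReal |(R ^ Module.finrank ℝ E)⁻¹| * homEnergy s F μ := by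
  have weight (ξ : E) : ‖ξ‖ₑ ^ s = ‖R⁻¹‖ₑ ^ s * ‖R • ξ‖ₑ ^ s := by
    rw [← ENNReal.mul_rpow_of_nonneg _ _ hs, ← enorm_smul, inv_smul_smul₀ hR]
  rw [mul_assoc, homEnergy, homEnergy, ← lintegral_comp_smul _ hR,
    ← lintegral_const_mul' _ _ (by finiteness)]
  refine lintegral_congr fun ξ => ?_
  rw [weight, mul_assoc, mul_pow]

theorem dilation_lconvolution (k G : E → ℝ≥0∞) {R : ℝ} (hR : R ≠ 0) (ξ : E) :
    ((fun x => ENNReal.ofReal |R ^ Module.finrank ℝ E| * k (R • x)) ⋆ₗ[μ] G) ξ =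
      (k ⋆ₗ[μ] fun x => G (R⁻¹ • x)) (R • ξ) := by
  have cancel : ENNReal.ofReal |R ^ Module.finrank ℝ E| *
      ENNReal.ofReal |(R ^ Module.finrank ℝ E)⁻¹| = 1 := by
    rw [← ENNReal.ofReal_mul (abs_nonneg _), ← abs_mul, mul_inv_cancel₀ (by positivity), abs_one,
      ENNReal.ofReal_one]
  have comp := lintegral_comp_smul (μ := μ) (fun y => k y * G (R⁻¹ • (-y + R • ξ))) hR
  simp only [smul_add, smul_neg, inv_smul_smul₀ hR] at comp
  simp only [lconvolution_def, mul_assoc, smul_add, smul_neg, inv_smul_smul₀ hR]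
  rw [lintegral_const_mul' _ _ (by finiteness), comp, ← mul_assoc, cancel, one_mul]

/-- By homogeneity of the energy under dilations, the bound for `R = 1` holds at all scales. -/
theorem exists_homEnergy_dilation_lconvolution_le {s : ℝ} (hs₀ : 0 ≤ s)
    (hs : 2 * s < Module.finrank ℝ E) {k : E → ℝ≥0∞} (hk : Measurable k)
    (hk_int : ∫⁻ x, k x ∂μ ≠ ⊤) (hk_weight : ∫⁻ x, ‖x‖ₑ ^ s * k x ∂μ ≠ ⊤)
    (hk_energy : homEnergy s k μ ≠ ⊤) :
    ∃ C : ℝ≥0∞, C ≠ ⊤ ∧ ∀ G : E → ℝ≥0∞, Measurable G → ∀ R : ℝ, R ≠ 0 →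
      homEnergy s ((fun x => ENNReal.ofReal |R ^ Module.finrank ℝ E| * k (R • x)) ⋆ₗ[μ] G) μ ≤
        C * homEnergy s G μ := by
  have hE : 0 < Module.finrank ℝ E := by exact_mod_cast (by positivity : 0 ≤ 2 * s).trans_lt hs
  have : Nontrivial E := Module.nontrivial_of_finrank_pos hE
  have hB := (homEnergy_neg_indicator_ball_lt_top (μ := μ) hE hs).ne
  obtain ⟨C, hC, bound⟩ : ∃ C : ℝ≥0∞, C ≠ ⊤ ∧ ∀ G : E → ℝ≥0∞, AEMeasurable G μ →
      homEnergy s (k ⋆ₗ[μ] G) μ ≤ C * homEnergy s G μ :=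
    ⟨_, by finiteness, fun G hG => homEnergy_lconvolution_le hs₀ hk.aemeasurable hG⟩
  refine ⟨C, hC, fun G hG R hR => ?_⟩
  have scaleG := homEnergy_comp_smul (μ := μ) hs₀ (fun x => G (R⁻¹ • x)) hR
  simp only [inv_smul_smul₀ hR] at scaleG
  rw [funext (dilation_lconvolution k G hR), homEnergy_comp_smul hs₀ _ hR, scaleG, mul_left_comm]
  gcongr
  exact bound _ (by fun_prop)

end Dilation

section Schwartz

variable {E F : Type*} [NormedAddCommGroup E] [NormedSpace ℝ E] [NormedAddCommGroup F]
  [NormedSpace ℝ F]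

theorem exists_enorm_schwartz_le (φ : 𝓢(E, F)) : ∃ C : ℝ≥0∞, C ≠ ⊤ ∧ ∀ ξ, ‖φ ξ‖ₑ ≤ C :=
  ⟨ENNReal.ofReal (SchwartzMap.seminorm ℝ 0 0 φ), ENNReal.ofReal_ne_top, fun ξ =>
    ofReal_norm (φ ξ) ▸ ENNReal.ofReal_le_ofReal (SchwartzMap.norm_le_seminorm ℝ φ ξ)⟩

variable [FiniteDimensional ℝ E] [MeasurableSpace E] [BorelSpace E] {μ : Measure E}
  [μ.IsAddHaarMeasure]

theorem lintegral_enorm_rpow_mul_enorm_schwartz_lt_top (φ : 𝓢(E, F)) {r : ℝ} (hr : 0 ≤ r) :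
    ∫⁻ ξ, ‖ξ‖ₑ ^ r * ‖φ ξ‖ₑ ∂μ < ⊤ := by
  obtain ⟨k, hk⟩ := exists_nat_ge r
  refine lt_of_le_of_lt (lintegral_mono fun ξ => ?_)
    (φ.integrable.norm.add (φ.integrable_pow_mul μ k)).2
  have weight : ‖ξ‖ ^ r ≤ 1 + ‖ξ‖ ^ k := by
    rcases le_total ‖ξ‖ 1 with h | h
    · exact (Real.rpow_le_one (norm_nonneg ξ) h hr).trans (le_add_of_nonneg_right (by positivity))
    · rw [← Real.rpow_natCast]
      exact (Real.rpow_le_rpow_of_exponent_le h hk).trans (le_add_of_nonneg_left zero_le_one)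
  rw [← enorm_norm ξ, ← Real.enorm_rpow_of_nonneg (norm_nonneg ξ) hr, ← enorm_norm (φ ξ),
    ← enorm_mul, enorm_le_iff_norm_le, Real.norm_of_nonneg (by positivity)]
  refine le_trans ?_ (Real.le_norm_self _)
  calc ‖ξ‖ ^ r * ‖φ ξ‖ ≤ (1 + ‖ξ‖ ^ k) * ‖φ ξ‖ := by gcongr
    _ = ‖φ ξ‖ + ‖ξ‖ ^ k * ‖φ ξ‖ := by ring

theorem homEnergy_schwartz_lt_top (φ : 𝓢(E, F)) {s : ℝ} (hs : 0 ≤ s) :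
    homEnergy s (fun ξ => ‖φ ξ‖ₑ) μ < ⊤ := by
  obtain ⟨C, hC, hφ⟩ := exists_enorm_schwartz_le φ
  calc homEnergy s (fun ξ => ‖φ ξ‖ₑ) μ ≤ ∫⁻ ξ, C * (‖ξ‖ₑ ^ (2 * s) * ‖φ ξ‖ₑ) ∂μ := by
        refine lintegral_mono fun ξ => ?_
        calc (‖ξ‖ₑ ^ s * ‖φ ξ‖ₑ) ^ 2 = ‖φ ξ‖ₑ * (‖ξ‖ₑ ^ (2 * s) * ‖φ ξ‖ₑ) := by
              rw [two_mul, ENNReal.rpow_add_of_nonneg _ _ hs hs]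
              ring
          _ ≤ C * (‖ξ‖ₑ ^ (2 * s) * ‖φ ξ‖ₑ) := by
              gcongr
              exact hφ ξ
    _ < ⊤ := by
        rw [lintegral_const_mul' _ _ hC]
        exact ENNReal.mul_lt_top hC.lt_top
          (lintegral_enorm_rpow_mul_enorm_schwartz_lt_top φ (by positivity))

theorem homEnergy_neg_schwartz_lt_top (φ : 𝓢(E, F)) {s : ℝ} (hs₀ : 0 ≤ s)
    (hs : 2 * s < Module.finrank ℝ E) : homEnergy (-s) (fun ξ => ‖φ ξ‖ₑ) μ < ⊤ := by
  have hE : 0 < Module.finrank ℝ E := by exact_mod_cast (by positivity : 0 ≤ 2 * s).trans_lt hs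
  obtain ⟨C, hC, hφ⟩ := exists_enorm_schwartz_le φ
  have hB := homEnergy_neg_indicator_ball_lt_top (μ := μ) hE hs
  have hφ2 : ∫⁻ ξ, ‖φ ξ‖ₑ ^ 2 ∂μ < ⊤ := by
    simpa [homEnergy] using homEnergy_schwartz_lt_top (μ := μ) φ le_rfl
  exact (homEnergy_neg_le_of_le hs₀ φ.continuous.enorm.aemeasurable hC hφ).trans_lt
    (by finiteness)

theorem lintegral_enorm_schwartz_mul_lt_top (φ : 𝓢(E, F)) {s : ℝ} (hs₀ : 0 ≤ s)
    (hs : 2 * s < Module.finrank ℝ E) {G : E → ℝ≥0∞} (hG : AEMeasurable G μ)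
    (hG_energy : homEnergy s G μ < ⊤) : ∫⁻ ξ, ‖φ ξ‖ₑ * G ξ ∂μ < ⊤ := by
  have : Nontrivial E := Module.nontrivial_of_finrank_pos (R := ℝ) (by
    exact_mod_cast (by positivity : 0 ≤ 2 * s).trans_lt hs)
  have pairing := (sq_lintegral_mul_le_homEnergy_mul_homEnergy s
    φ.continuous.enorm.aemeasurable hG).trans_lt
    (ENNReal.mul_lt_top (homEnergy_neg_schwartz_lt_top φ hs₀ hs) hG_energy)
  simpa using pairing

end Schwartz

section Fourier

open scoped Convolution

theorem enorm_convolution_le {𝕜 G E E' F : Type*} [NontriviallyNormedField 𝕜] [AddCommGroup G]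
    [MeasurableSpace G] {μ : Measure G} [NormedAddCommGroup E] [NormedSpace 𝕜 E]
    [NormedAddCommGroup E'] [NormedSpace 𝕜 E'] [NormedAddCommGroup F] [NormedSpace 𝕜 F]
    [NormedSpace ℝ F] {L : E →L[𝕜] E' →L[𝕜] F} (hL : ‖L‖ ≤ 1) (f : G → E) (g : G → E') (x : G) :
    ‖(f ⋆[L, μ] g) x‖ₑ ≤ ((fun y => ‖f y‖ₑ) ⋆ₗ[μ] fun y => ‖g y‖ₑ) x := by
  refine (enorm_integral_le_lintegral_enorm _).trans (lintegral_mono fun y => ?_)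
  beta_reduce
  rw [← sub_eq_neg_add, ← enorm_norm (f y), ← enorm_norm (g (x - y)), ← enorm_mul,
    enorm_le_iff_norm_le, Real.norm_of_nonneg (by positivity)]
  refine (L.le_opNorm₂ _ _).trans ?_
  rw [mul_assoc]
  exact mul_le_of_le_one_left (by positivity) hL

theorem integral_fourier_mul_eq_of_integrable {V : Type*} [NormedAddCommGroup V]
    [InnerProductSpace ℝ V] [FiniteDimensional ℝ V] [MeasurableSpace V] [BorelSpace V]
    {f g : V → ℂ} (hf : Integrable f) (hg : Integrable g) :
    ∫ ξ, 𝓕 f ξ * g ξ = ∫ x, f x * 𝓕 g x := by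
  simpa using! VectorFourier.integral_fourierIntegral_smul_eq_flip (L := innerₗ V)
    Real.continuous_fourierChar continuous_inner hf hg

variable {d : ℕ}

namespace IsFourierTransformOf

theorem of_integrable {v : Eucl d → ℝ} (hv : Integrable v) :
    IsFourierTransformOf v (𝓕 fun x => (v x : ℂ)) := by
  have hc : Continuous (𝓕 fun x => (v x : ℂ)) :=
    VectorFourier.fourierIntegral_continuous Real.continuous_fourierChar continuous_inner hv.ofReal
  refine ⟨hc.aestronglyMeasurable, fun φ => ?_, fun φ => ?_⟩
  · refine φ.integrable.bdd_mul hc.aestronglyMeasurable (c := ∫ x, ‖(v x : ℂ)‖)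
      (Eventually.of_forall fun ξ => ?_)
    exact VectorFourier.norm_fourierIntegral_le_integral_norm _ _ _ _ _
  · rw [SchwartzMap.fourier_coe]
    exact (integral_fourier_mul_eq_of_integrable hv.ofReal φ.integrable).symm

theorem congr_right {u : Eucl d → ℝ} {g h : Eucl d → ℂ} (hg : IsFourierTransformOf u g)
    (hgh : g =ᵐ[volume] h) : IsFourierTransformOf u h where
  aestronglyMeasurable := hg.aestronglyMeasurable.congr hgh
  integrable_mul φ := (hg.integrable_mul φ).congr (hgh.mono fun x hx => by simp [hx])
  integral_eq φ := by
    rw [hg.integral_eq φ]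
    exact integral_congr_ae (hgh.mono fun x hx => by simp [hx])

end IsFourierTransformOf

theorem aestronglyMeasurable_sub_mul {K g : Eucl d → ℂ} (hK : Continuous K)
    (hg : AEStronglyMeasurable g volume) :
    AEStronglyMeasurable (fun z : Eucl d × Eucl d => K (z.1 - z.2) * g z.2)
      (volume.prod volume) :=
  (hK.comp (continuous_fst.sub continuous_snd)).aestronglyMeasurable.mul hg.comp_snd

theorem integrable_sub_mul_mul_schwartz {K g : Eucl d → ℂ} (hK : Continuous K)
    (hg : AEStronglyMeasurable g volume) (φ : 𝓢(Eucl d, ℂ))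
    (hfin : ∫⁻ ξ, ‖φ ξ‖ₑ * ((fun η => ‖K η‖ₑ) ⋆ₗ[volume] fun η => ‖g η‖ₑ) ξ < ⊤) :
    Integrable (fun z : Eucl d × Eucl d => K (z.1 - z.2) * g z.2 * φ z.1)
      (volume.prod volume) := by
  have hmeas : AEStronglyMeasurable (fun z : Eucl d × Eucl d => K (z.1 - z.2) * g z.2 * φ z.1)
      (volume.prod volume) :=
    (aestronglyMeasurable_sub_mul hK hg).mul
      (φ.continuous.comp continuous_fst).aestronglyMeasurable
  refine ⟨hmeas, ?_⟩
  rw [HasFiniteIntegral, lintegral_prod _ hmeas.enorm]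
  refine lt_of_le_of_lt (lintegral_mono fun ξ => le_of_eq ?_) hfin
  rw [lconvolution_comm, lconvolution_def, ← lintegral_const_mul' _ _ enorm_ne_top]
  refine lintegral_congr fun η => ?_
  rw [enorm_mul, enorm_mul, sub_eq_neg_add]
  ring

theorem integral_mul_fourier_mul {u : Eucl d → ℝ} {g : Eucl d → ℂ}
    (hg : IsFourierTransformOf u g) (Θ φ : 𝓢(Eucl d, ℂ)) :
    ∫ x, (u x : ℂ) * (Θ x * 𝓕 φ x) = ∫ η, ∫ ξ, 𝓕 Θ (ξ - η) * g η * φ ξ := by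
  let ψ := SchwartzMap.convolution (ContinuousLinearMap.mul ℂ ℂ) (𝓕⁻ Θ) φ
  have fourier_ψ (x : Eucl d) : 𝓕 ψ x = Θ x * 𝓕 φ x := by
    rw [SchwartzMap.fourier_convolution, SchwartzMap.pairing_apply_apply,
      FourierTransform.fourier_fourierInv_eq, ContinuousLinearMap.mul_apply']
  have ψ_apply (η : Eucl d) : ψ η = ∫ ξ, 𝓕 Θ (ξ - η) * φ ξ := by
    rw [SchwartzMap.convolution_apply, convolution_mul_swap]
    refine integral_congr_ae (Eventually.of_forall fun ξ => ?_)
    simp only [SchwartzMap.fourierInv_coe, SchwartzMap.fourier_coe, Real.fourierInv_eq_fourier_neg,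
      neg_sub]
  simp only [← fourier_ψ]
  rw [hg.integral_eq ψ]
  refine integral_congr_ae (Eventually.of_forall fun η => ?_)
  simp only [ψ_apply, ← integral_const_mul]
  refine integral_congr_ae (Eventually.of_forall fun ξ => ?_)
  ring

theorem IsFourierTransformOf.mul {u θ : Eucl d → ℝ} {g : Eucl d → ℂ}
    (hg : IsFourierTransformOf u g) {Θ : 𝓢(Eucl d, ℂ)} (hΘ : ∀ x, Θ x = θ x)
    (hfin : ∀ φ : 𝓢(Eucl d, ℂ),
      ∫⁻ ξ, ‖φ ξ‖ₑ * ((fun η => ‖𝓕 Θ η‖ₑ) ⋆ₗ[volume] fun η => ‖g η‖ₑ) ξ < ⊤) :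
    IsFourierTransformOf (fun x => θ x * u x)
      ((𝓕 Θ : 𝓢(Eucl d, ℂ)) ⋆[ContinuousLinearMap.mul ℂ ℂ] g) := by
  have hK : Continuous (𝓕 Θ : 𝓢(Eucl d, ℂ)) := SchwartzMap.continuous _
  have hint (φ : 𝓢(Eucl d, ℂ)) :=
    integrable_sub_mul_mul_schwartz hK hg.aestronglyMeasurable φ (hfin φ)
  have conv_apply (ξ : Eucl d) : ((𝓕 Θ : 𝓢(Eucl d, ℂ)) ⋆[ContinuousLinearMap.mul ℂ ℂ] g) ξ =
      ∫ η, 𝓕 Θ (ξ - η) * g η := convolution_mul_swap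
  rw [funext conv_apply]
  refine ⟨(aestronglyMeasurable_sub_mul hK hg.aestronglyMeasurable).integral_prod_right',
    fun φ => ?_, fun φ => ?_⟩
  · simpa only [integral_mul_const] using (hint φ).integral_prod_left
  · calc ∫ x, ((θ x * u x : ℝ) : ℂ) * 𝓕 φ x = ∫ x, (u x : ℂ) * (Θ x * 𝓕 φ x) := by
          refine integral_congr_ae (Eventually.of_forall fun x => ?_)
          simp only [hΘ, Complex.ofReal_mul]
          ring
      _ = ∫ η, ∫ ξ, 𝓕 Θ (ξ - η) * g η * φ ξ := integral_mul_fourier_mul hg Θ φ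
      _ = ∫ ξ, ∫ η, 𝓕 Θ (ξ - η) * g η * φ ξ := (integral_integral_swap (hint φ)).symm
      _ = _ := by simp only [integral_mul_const]

theorem enorm_weight_sq {s : ℝ} (hs : 0 ≤ s) (ξ : Eucl d) (z : ℂ) :
    (‖ξ‖ₑ ^ s * ‖z‖ₑ) ^ 2 = ENNReal.ofReal (‖ξ‖ ^ (2 * s) * ‖z‖ ^ 2) := by
  rw [← norm_weight_sq, ENNReal.ofReal_pow (norm_nonneg _), ofReal_norm, enorm_smul,
    Real.enorm_rpow_of_nonneg (norm_nonneg ξ) hs, enorm_norm]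

theorem integrable_weight_sq {s : ℝ} (hs : 0 ≤ s) {g : Eucl d → ℂ}
    (hg : AEStronglyMeasurable g volume) (hfin : homEnergy s (fun ξ => ‖g ξ‖ₑ) volume < ⊤) :
    Integrable (fun ξ => ‖ξ‖ ^ (2 * s) * ‖g ξ‖ ^ 2) volume := by
  have hm : Measurable fun ξ : Eucl d => ‖ξ‖ ^ (2 * s) := by fun_prop
  refine ⟨hm.aestronglyMeasurable.mul (hg.norm.pow 2), ?_⟩
  rw [hasFiniteIntegral_iff_ofReal (Eventually.of_forall fun ξ => by positivity)]
  simpa only [homEnergy, enorm_weight_sq hs] using hfin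

variable {θ : Eucl d → ℝ}

/-- A test function seen as a complex-valued Schwartz function, to which Mathlib's Fourier
transform applies. -/
noncomputable def complexSchwartz (hθ : ContDiff ℝ ∞ θ) (hc : HasCompactSupport θ) :
    𝓢(Eucl d, ℂ) :=
  (hc.comp_left (g := fun t : ℝ => (t : ℂ)) (by simp)).toSchwartzMap
    (Complex.ofRealCLM.contDiff.comp hθ)

theorem complexSchwartz_apply (hθ : ContDiff ℝ ∞ θ) (hc : HasCompactSupport θ) (x : Eucl d) :
    complexSchwartz hθ hc x = θ x := rfl

theorem hasCompactSupport_comp_inv_smul (hc : HasCompactSupport θ) {R : ℝ} (hR : 0 < R) :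
    HasCompactSupport fun x => θ (R⁻¹ • x) :=
  hc.comp_homeomorph (Homeomorph.smulOfNeZero R⁻¹ (inv_ne_zero hR.ne'))

theorem contDiff_comp_inv_smul (hθ : ContDiff ℝ ∞ θ) (R : ℝ) :
    ContDiff ℝ ∞ fun x => θ (R⁻¹ • x) :=
  hθ.comp (contDiff_const_smul _)

theorem fourier_complexSchwartz_comp_inv_smul (hθ : ContDiff ℝ ∞ θ) (hc : HasCompactSupport θ)
    {R : ℝ} (hR : 0 < R) (ξ : Eucl d) :
    𝓕 (complexSchwartz (contDiff_comp_inv_smul hθ R) (hasCompactSupport_comp_inv_smul hc hR)) ξ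
      = (R ^ d : ℝ) • 𝓕 (complexSchwartz hθ hc) (R • ξ) := by
  simp only [SchwartzMap.fourier_coe, Real.fourier_eq, complexSchwartz_apply]
  have change := Measure.integral_comp_inv_smul_of_nonneg volume
    (fun x : Eucl d => Real.fourierChar (-inner ℝ x (R • ξ)) • (θ x : ℂ)) hR.le
  rw [finrank_euclideanSpace_fin] at change
  rw [← change]
  refine integral_congr_ae (Eventually.of_forall fun x => ?_)
  simp only [real_inner_smul_left, real_inner_smul_right, mul_inv_cancel_left₀ hR.ne']

end Fourier

theorem tendsto_inner_zero_of_total {𝕜 H ι : Type*} [RCLike 𝕜] [NormedAddCommGroup H]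
    [InnerProductSpace 𝕜 H] [CompleteSpace H] {l : Filter ι} {x : ι → H} {C : NNReal}
    (hx : ∀ i, ‖x i‖ ≤ C) {D : Set H} (hD : ∀ w, (∀ v ∈ D, inner 𝕜 v w = 0) → w = 0)
    (h : ∀ v ∈ D, Tendsto (fun i => inner 𝕜 v (x i)) l (𝓝 0)) (w : H) :
    Tendsto (fun i => inner 𝕜 w (x i)) l (𝓝 0) := by
  let S : Submodule 𝕜 H :=
    { carrier := {w | Tendsto (fun i => inner 𝕜 w (x i)) l (𝓝 0)}
      add_mem' := fun {a b} ha hb => by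
        simpa [inner_add_left] using! Tendsto.add ha hb
      zero_mem' := by simpa using tendsto_const_nhds
      smul_mem' := fun c a ha => by
        simpa [inner_smul_left, mul_comm] using! Tendsto.const_mul (starRingEnd 𝕜 c) ha }
  have hlip (i : ι) : LipschitzWith C fun w => inner 𝕜 w (x i) :=
    LipschitzWith.of_dist_le_mul fun a b => by
      rw [dist_eq_norm, dist_eq_norm, ← inner_sub_left, mul_comm]
      exact (norm_inner_le_norm _ _).trans (by gcongr; exact hx i)
  have hclosed : IsClosed (S : Set H) :=
    (LipschitzWith.uniformEquicontinuous _ C hlip).equicontinuous.isClosed_setOfPred_tendsto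
      continuous_const
  have hdense : S.topologicalClosure = ⊤ := by
    rw [Submodule.topologicalClosure_eq_top_iff, Submodule.eq_bot_iff]
    exact fun w hw => hD w fun v hv => (Submodule.mem_orthogonal S w).1 hw v (h v hv)
  have hS : S = ⊤ := hclosed.submodule_topologicalClosure_eq ▸ hdense
  exact (hS ▸ Submodule.mem_top : w ∈ S)

theorem contDiff_norm_rpow_mul {E : Type*} [NormedAddCommGroup E] [InnerProductSpace ℝ E] (s : ℝ)
    {φ : E → ℝ} (hφ : ContDiff ℝ ∞ φ) (h0 : tsupport φ ⊆ {0}ᶜ) :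
    ContDiff ℝ ∞ fun ξ => ‖ξ‖ ^ s * φ ξ := by
  rw [contDiff_iff_contDiffAt]
  intro ξ
  by_cases hξ : ξ = 0
  · have hzero : (fun ξ => ‖ξ‖ ^ s * φ ξ) =ᶠ[𝓝 ξ] fun _ => 0 := by
      filter_upwards [notMem_tsupport_iff_eventuallyEq.1 fun h => h0 h hξ] with y hy
      rw [hy, Pi.zero_apply, mul_zero]
    exact contDiffAt_const.congr_of_eventuallyEq hzero
  · exact ((contDiffAt_id.norm ℝ hξ).rpow_const_of_ne (norm_ne_zero_iff.2 hξ)).mul hφ.contDiffAt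

theorem eq_zero_of_inner_complexSchwartz_eq_zero {d : ℕ} [Nontrivial (Eucl d)]
    {v : Lp ℂ 2 (volume : Measure (Eucl d))}
    (hv : ∀ (φ : Eucl d → ℝ) (hφ : ContDiff ℝ ∞ φ) (hc : HasCompactSupport φ),
      tsupport φ ⊆ {0}ᶜ → inner ℂ ((complexSchwartz hφ hc).memLp 2 volume).toLp v = 0) :
    v = 0 := by
  rw [Lp.eq_zero_iff_ae_eq_zero]
  have hloc : LocallyIntegrable v volume := (Lp.memLp v).locallyIntegrable one_le_two
  have hzero := isOpen_compl_singleton.ae_eq_zero_of_integral_contDiff_smul_eq_zero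
    (U := {(0 : Eucl d)}ᶜ) (hloc.locallyIntegrableOn _) fun φ hφ hc h0 => ?_
  · filter_upwards [hzero, compl_mem_ae_iff.2 (measure_singleton (0 : Eucl d))] with ξ hξ hξ0
    exact hξ hξ0
  · rw [← hv φ hφ hc h0, L2.inner_def]
    refine integral_congr_ae ?_
    filter_upwards [((complexSchwartz hφ hc).memLp 2 volume).coeFn_toLp] with ξ hξ
    rw [hξ, complexSchwartz_apply, RCLike.inner_apply, Complex.conj_ofReal, Complex.real_smul,
      mul_comm]

theorem tendsto_integral_smul_of_tendsto_eLpNorm {α F ι : Type*} [MeasurableSpace α]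
    {μ : Measure α} [NormedAddCommGroup F] [NormedSpace ℝ F] {l : Filter ι} {p q : ℝ≥0∞}
    [ENNReal.HolderConjugate p q] {f : ι → α → ℝ} {f₀ : α → ℝ} {g : α → F}
    (hf : ∀ i, MemLp (f i) p μ) (hf₀ : MemLp f₀ p μ) (hg : MemLp g q μ)
    (h : Tendsto (fun i => eLpNorm (f i - f₀) p μ) l (𝓝 0)) :
    Tendsto (fun i => ∫ x, f i x • g x ∂μ) l (𝓝 (∫ x, f₀ x • g x ∂μ)) := by
  have hint {k : α → ℝ} (hk : MemLp k p μ) : Integrable (k • g) μ :=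
    memLp_one_iff_integrable.1 (hg.smul hk)
  have hbound : Tendsto (fun i => eLpNorm (f i - f₀) p μ * eLpNorm g q μ) l (𝓝 0) := by
    simpa using ENNReal.Tendsto.mul_const h (Or.inr hg.2.ne)
  refine tendsto_integral_of_L1' (fun x => f₀ x • g x) (hint hf₀).1
    (Eventually.of_forall fun i => hint (hf i)) ?_
  refine tendsto_of_tendsto_of_tendsto_of_le_of_le tendsto_const_nhds hbound (fun _ => zero_le)
    fun i => ?_
  rw [show (fun x => f i x • g x) - (fun x => f₀ x • g x) = (f i - f₀) • g from
    (sub_smul (f i) f₀ g).symm]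
  exact eLpNorm_smul_le_mul_eLpNorm hg.1 ((hf i).sub hf₀).1

theorem exists_seq_contDiffBump_tendsto_rOut_zero (E : Type*) [NormedAddCommGroup E] :
    ∃ φ : ℕ → ContDiffBump (0 : E),
      (∀ n, (φ n).rOut ≤ 1) ∧ Tendsto (fun n => (φ n).rOut) atTop (𝓝 0) := by
  refine ⟨fun n => ⟨1 / (n + 1) / 2, 1 / (n + 1), by positivity, half_lt_self (by positivity)⟩,
    fun n => ?_, tendsto_one_div_add_atTop_nhds_zero_nat⟩
  exact (div_le_one (by positivity)).2 (by linarith [(Nat.cast_nonneg n : (0 : ℝ) ≤ n)])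

section Mollifier

open scoped Convolution

variable {E F : Type*} [NormedAddCommGroup E] [NormedSpace ℝ E] [HasContDiffBump E]
  [MeasurableSpace E] [NormedAddCommGroup F] [NormedSpace ℝ F]

/-- The mollification of `f` by the probability density proportional to the bump function `φ`. -/
noncomputable def mollify (φ : ContDiffBump (0 : E)) (μ : Measure E) (f : E → F) : E → F :=
  φ.normed μ ⋆[ContinuousLinearMap.lsmul ℝ ℝ, μ] f

variable [BorelSpace E] [FiniteDimensional ℝ E] {μ : Measure E} [μ.IsAddHaarMeasure]

theorem contDiff_mollify (φ : ContDiffBump (0 : E)) {f : E → F} (hf : LocallyIntegrable f μ) :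
    ContDiff ℝ ∞ (mollify φ μ f) :=
  φ.hasCompactSupport_normed.contDiff_convolution_left _ φ.contDiff_normed hf

theorem mollify_sub (φ : ContDiffBump (0 : E)) {f g : E → F} (hf : LocallyIntegrable f μ)
    (hg : LocallyIntegrable g μ) : mollify φ μ (f - g) = mollify φ μ f - mollify φ μ g := by
  have hexists {h : E → F} (hh : LocallyIntegrable h μ) :
      ConvolutionExists (φ.normed μ) h (ContinuousLinearMap.lsmul ℝ ℝ) μ :=
    φ.hasCompactSupport_normed.convolutionExists_left _ φ.continuous_normed hh
  rw [eq_sub_iff_add_eq, mollify, mollify, mollify,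
    ← (hexists (hf.sub hg)).distrib_add (hexists hg), sub_add_cancel]

theorem support_mollify_subset (φ : ContDiffBump (0 : E)) {f : E → F} {K : Set E}
    (hf : ∀ᵐ x ∂μ, x ∉ K → f x = 0) :
    Function.support (mollify φ μ f) ⊆ Metric.cthickening φ.rOut K := by
  have hind : f =ᵐ[μ] K.indicator f := by
    filter_upwards [hf] with x hx
    by_cases hxK : x ∈ K
    · rw [Set.indicator_of_mem hxK]
    · rw [Set.indicator_of_notMem hxK, hx hxK]
  rw [mollify, convolution_congr _ ae_eq_rfl hind]
  refine (support_convolution_subset _).trans ?_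
  rw [φ.support_normed_eq]
  rintro _ ⟨y, hy, x, hx, rfl⟩
  refine Metric.mem_cthickening_of_dist_le _ x _ _ (Set.support_indicator_subset hx) ?_
  simpa using (mem_ball_zero_iff.1 hy).le

theorem hasCompactSupport_mollify (φ : ContDiffBump (0 : E)) {f : E → F} {K : Set E}
    (hK : IsCompact K) (hf : ∀ᵐ x ∂μ, x ∉ K → f x = 0) : HasCompactSupport (mollify φ μ f) :=
  .of_support_subset_isCompact hK.cthickening (support_mollify_subset φ hf)

theorem lintegral_enorm_normed (φ : ContDiffBump (0 : E)) : ∫⁻ x, ‖φ.normed μ x‖ₑ ∂μ = 1 := by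
  rw [← ofReal_integral_norm_eq_lintegral_enorm φ.integrable_normed]
  simp only [Real.norm_of_nonneg (φ.nonneg_normed _), φ.integral_normed, ENNReal.ofReal_one]

theorem eLpNorm_mollify_le (φ : ContDiffBump (0 : E)) {p : ℝ≥0∞} (hp : 1 ≤ p) (hp' : p ≠ ⊤)
    {f : E → F} (hf : AEStronglyMeasurable f μ) :
    eLpNorm (mollify φ μ f) p μ ≤ eLpNorm f p μ := by
  have hp0 : p ≠ 0 := (one_pos.trans_le hp).ne'
  have hp1 : 1 ≤ p.toReal := by simpa using ENNReal.toReal_mono hp' hp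
  rw [eLpNorm_eq_lintegral_rpow_enorm_toReal hp0 hp',
    eLpNorm_eq_lintegral_rpow_enorm_toReal hp0 hp']
  refine ENNReal.rpow_le_rpow ?_ (by positivity)
  calc ∫⁻ x, ‖mollify φ μ f x‖ₑ ^ p.toReal ∂μ
      ≤ ∫⁻ x, ((fun y => ‖φ.normed μ y‖ₑ) ⋆ₗ[μ] fun y => ‖f y‖ₑ) x ^ p.toReal ∂μ := by
        refine lintegral_mono fun x => ENNReal.rpow_le_rpow ?_ (by positivity)
        exact enorm_convolution_le (L := ContinuousLinearMap.lsmul ℝ ℝ)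
          ContinuousLinearMap.opNorm_lsmul_le _ f x
    _ ≤ (∫⁻ x, ‖φ.normed μ x‖ₑ ∂μ) ^ p.toReal * ∫⁻ x, ‖f x‖ₑ ^ p.toReal ∂μ :=
        lintegral_lconvolution_rpow_le hp1 φ.continuous_normed.measurable.enorm.aemeasurable
          hf.enorm
    _ = ∫⁻ x, ‖f x‖ₑ ^ p.toReal ∂μ := by
        rw [lintegral_enorm_normed, ENNReal.one_rpow, one_mul]

theorem memLp_mollify (φ : ContDiffBump (0 : E)) {p : ℝ≥0∞} (hp : 1 ≤ p) (hp' : p ≠ ⊤)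
    {f : E → F} (hf : MemLp f p μ) : MemLp (mollify φ μ f) p μ :=
  ⟨(contDiff_mollify φ (hf.locallyIntegrable hp)).continuous.aestronglyMeasurable,
    (eLpNorm_mollify_le φ hp hp' hf.1).trans_lt hf.2⟩

variable [CompleteSpace F] {ι : Type*} {l : Filter ι} {φ : ι → ContDiffBump (0 : E)}

theorem tendstoUniformly_mollify (hφ : Tendsto (fun i => (φ i).rOut) l (𝓝 0)) {f : E → F}
    (hf : UniformContinuous f) : TendstoUniformly (fun i => mollify (φ i) μ f) f l := by
  rw [Metric.tendstoUniformly_iff]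
  intro ε hε
  obtain ⟨δ, hδ, hfδ⟩ := Metric.uniformContinuous_iff.1 hf (ε / 2) (half_pos hε)
  filter_upwards [hφ.eventually_lt_const hδ] with i hi x
  rw [dist_comm]
  refine lt_of_le_of_lt ?_ (half_lt_self hε)
  exact (φ i).dist_normed_convolution_le hf.continuous.aestronglyMeasurable fun y hy =>
    (hfδ ((Metric.mem_ball.1 hy).trans hi)).le

theorem tendsto_eLpNorm_mollify_sub_of_continuous (hφ : Tendsto (fun i => (φ i).rOut) l (𝓝 0))
    {p : ℝ≥0∞} (hp : p ≠ ⊤) {f : E → F} (hf : Continuous f) (hc : HasCompactSupport f) :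
    Tendsto (fun i => eLpNorm (mollify (φ i) μ f - f) p μ) l (𝓝 0) := by
  have hK : IsCompact (Metric.cthickening 1 (tsupport f)) := hc.isCompact.cthickening
  have huniform := Metric.tendstoUniformly_iff.1
    (tendstoUniformly_mollify (μ := μ) hφ (hc.uniformContinuous_of_continuous hf))
  have hsmall : Tendsto (fun ε => ENNReal.ofReal ε *
      μ (Metric.cthickening 1 (tsupport f)) ^ (1 / p.toReal)) (𝓝[>] 0) (𝓝 0) := by
    have hfin : μ (Metric.cthickening 1 (tsupport f)) ^ (1 / p.toReal) ≠ ⊤ :=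
      ENNReal.rpow_ne_top_of_nonneg (by positivity) hK.measure_lt_top.ne
    simpa using ENNReal.Tendsto.mul_const
      ((ENNReal.continuous_ofReal.tendsto 0).mono_left nhdsWithin_le_nhds) (Or.inr hfin)
  rw [ENNReal.tendsto_nhds_zero]
  intro η hη
  obtain ⟨ε, hεη, hε⟩ :=
    ((ENNReal.tendsto_nhds_zero.1 hsmall η hη).and self_mem_nhdsWithin).exists
  filter_upwards [huniform ε hε, hφ.eventually_le_const one_pos] with i hi hr
  refine (eLpNorm_sub_le_of_dist_bdd μ hp hK.measurableSet hε.le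
    (fun x => (dist_comm _ _).trans_le (hi x).le) ?_ ?_).trans hεη
  · exact (support_mollify_subset _ (Eventually.of_forall fun x hx =>
      image_eq_zero_of_notMem_tsupport hx)).trans (Metric.cthickening_mono hr _)
  · exact subset_closure.trans (Metric.self_subset_cthickening _)

theorem tendsto_eLpNorm_mollify_sub (hφ : Tendsto (fun i => (φ i).rOut) l (𝓝 0)) {p : ℝ≥0∞}
    (hp : 1 ≤ p) (hp' : p ≠ ⊤) {f : E → F} (hf : MemLp f p μ) :
    Tendsto (fun i => eLpNorm (mollify (φ i) μ f - f) p μ) l (𝓝 0) := by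
  rw [ENNReal.tendsto_nhds_zero]
  intro ε hε
  have hε3 : ε / 3 ≠ 0 := (ENNReal.div_pos hε.ne' (by simp)).ne'
  obtain ⟨g, hgc, hfg, hg, hgp⟩ := hf.exists_hasCompactSupport_eLpNorm_sub_le hp' hε3
  have hfg_loc : LocallyIntegrable (f - g) μ := (hf.sub hgp).locallyIntegrable hp
  filter_upwards [ENNReal.tendsto_nhds_zero.1
    (tendsto_eLpNorm_mollify_sub_of_continuous (μ := μ) hφ hp' hg hgc) (ε / 3)
    (pos_iff_ne_zero.2 hε3)] with i hi
  have split : mollify (φ i) μ f - f =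
      mollify (φ i) μ (f - g) + (mollify (φ i) μ g - g) + (g - f) := by
    rw [mollify_sub (μ := μ) _ (hf.locallyIntegrable hp) hg.locallyIntegrable]
    abel
  have hmeas : AEStronglyMeasurable (mollify (φ i) μ (f - g)) μ :=
    (contDiff_mollify _ hfg_loc).continuous.aestronglyMeasurable
  have hmeas' : AEStronglyMeasurable (mollify (φ i) μ g - g) μ :=
    ((contDiff_mollify _ hg.locallyIntegrable).continuous.sub hg).aestronglyMeasurable
  calc eLpNorm (mollify (φ i) μ f - f) p μ
      ≤ eLpNorm (mollify (φ i) μ (f - g)) p μ + eLpNorm (mollify (φ i) μ g - g) p μ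
          + eLpNorm (g - f) p μ := by
        rw [split]
        refine (eLpNorm_add_le (hmeas.add hmeas') (hgp.1.sub hf.1) hp).trans ?_
        gcongr
        exact eLpNorm_add_le hmeas hmeas' hp
    _ ≤ ε / 3 + ε / 3 + ε / 3 := by
        rw [eLpNorm_sub_comm g f]
        gcongr
        exact (eLpNorm_mollify_le _ hp hp' hfg_loc.aestronglyMeasurable).trans hfg
    _ = ε := ENNReal.add_thirds ε

omit [CompleteSpace F] in
theorem tendsto_integral_mollify_smul (hφ : Tendsto (fun i => (φ i).rOut) l (𝓝 0))
    {p q : ℝ≥0∞} [ENNReal.HolderConjugate p q] (hp : p ≠ ⊤) {f : E → ℝ} {g : E → F}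
    (hf : MemLp f p μ) (hg : MemLp g q μ) :
    Tendsto (fun i => ∫ x, mollify (φ i) μ f x • g x ∂μ) l (𝓝 (∫ x, f x • g x ∂μ)) :=
  have hp1 : 1 ≤ p := ENNReal.HolderConjugate.one_le p q
  tendsto_integral_smul_of_tendsto_eLpNorm (fun i => memLp_mollify (φ i) hp1 hp hf) hf hg
    (tendsto_eLpNorm_mollify_sub hφ hp1 hp hf)

end Mollifier

section FourierMollify

open scoped Convolution

variable {E : Type*} [NormedAddCommGroup E] [InnerProductSpace ℝ E] [FiniteDimensional ℝ E]
  [MeasurableSpace E] [BorelSpace E]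

theorem norm_fourier_mollify_le (φ : ContDiffBump (0 : E)) {f : E → ℂ} (hf : Integrable f)
    (ξ : E) : ‖𝓕 (mollify φ volume f) ξ‖ ≤ ‖𝓕 f ξ‖ := by
  have hconv : mollify φ volume f = (fun x => (φ.normed volume x : ℂ))
      ⋆[ContinuousLinearMap.mul ℂ ℂ, volume] f := by
    ext x
    simp [mollify, convolution_def]
  have hnormed : ‖𝓕 (fun x => (φ.normed volume x : ℂ)) ξ‖ ≤ 1 := by
    refine (VectorFourier.norm_fourierIntegral_le_integral_norm _ _ _ _ _).trans_eq ?_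
    simp only [Complex.norm_real, Real.norm_of_nonneg (φ.nonneg_normed _), φ.integral_normed]
  have hfourier := Real.fourier_mul_convolution_eq
    (φ.integrable_normed (μ := volume)).ofReal hf ξ (R := ℂ)
  rw [hconv]
  refine (congrArg norm hfourier).trans_le ?_
  rw [norm_mul]
  exact mul_le_of_le_one_left (norm_nonneg _) hnormed

end FourierMollify

section Exhaustion

variable {α : Type*} [MeasurableSpace α] {μ : Measure α} {χ : ℕ → α → ℝ}

theorem tendsto_integral_smul_of_tendsto_one {F : Type*} [NormedAddCommGroup F]
    [NormedSpace ℝ F] (hm : ∀ n, AEStronglyMeasurable (χ n) μ) (h0 : ∀ n x, 0 ≤ χ n x)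
    (h1 : ∀ n x, χ n x ≤ 1) (hχ : ∀ x, Tendsto (fun n => χ n x) atTop (𝓝 1)) {f : α → F}
    (hf : Integrable f μ) :
    Tendsto (fun n => ∫ x, χ n x • f x ∂μ) atTop (𝓝 (∫ x, f x ∂μ)) := by
  refine tendsto_integral_of_dominated_convergence (fun x => ‖f x‖) (fun n => (hm n).smul hf.1)
    hf.norm (fun n => Eventually.of_forall fun x => ?_) (Eventually.of_forall fun x => ?_)
  · rw [norm_smul, Real.norm_of_nonneg (h0 n x)]
    exact mul_le_of_le_one_left (norm_nonneg _) (h1 n x)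
  · simpa using (hχ x).smul_const (f x)

theorem integrable_of_tendsto_of_integral_le {G : ℕ → α → ℝ} {g : α → ℝ} {C : ℝ}
    (hG : ∀ n, Integrable (G n) μ) (hG0 : ∀ n, 0 ≤ᵐ[μ] G n) (hC : ∀ n, ∫ x, G n x ∂μ ≤ C)
    (hlim : ∀ᵐ x ∂μ, Tendsto (fun n => G n x) atTop (𝓝 (g x))) : Integrable g μ := by
  have hbound (n : ℕ) : eLpNorm (G n) 1 μ ≤ ENNReal.ofReal C := by
    rw [eLpNorm_one_eq_lintegral_enorm, ← ofReal_integral_norm_eq_lintegral_enorm (hG n)]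
    refine ENNReal.ofReal_le_ofReal (le_of_eq_of_le (integral_congr_ae ?_) (hC n))
    exact (hG0 n).mono fun x hx => Real.norm_of_nonneg hx
  rw [← memLp_one_iff_integrable]
  refine ⟨aestronglyMeasurable_of_tendsto_ae _ (fun n => (hG n).1) hlim, ?_⟩
  calc eLpNorm g 1 μ
      ≤ liminf (fun n => eLpNorm (G n) 1 μ) atTop :=
        Lp.eLpNorm_lim_le_liminf_eLpNorm (fun n => (hG n).1) g hlim
    _ ≤ ENNReal.ofReal C := liminf_le_of_frequently_le' (.of_forall hbound)
    _ < ⊤ := ENNReal.ofReal_lt_top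

theorem integrable_of_neg_abs_le_of_integral_mul_le (hm : ∀ n, AEStronglyMeasurable (χ n) μ)
    (h0 : ∀ n x, 0 ≤ χ n x) (h1 : ∀ n x, χ n x ≤ 1)
    (hχ : ∀ x, Tendsto (fun n => χ n x) atTop (𝓝 1)) {f g : α → ℝ} {C : ℝ}
    (hf : Integrable f μ) (hfg : ∀ᵐ x ∂μ, -|f x| ≤ g x)
    (hg : ∀ n, Integrable (fun x => χ n x * g x) μ) (hC : ∀ n, ∫ x, χ n x * g x ∂μ ≤ C) :
    Integrable g μ := by
  have hχf (n : ℕ) : Integrable (fun x => χ n x * |f x|) μ :=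
    hf.abs.bdd_mul (hm n) (Eventually.of_forall fun x =>
      (Real.norm_of_nonneg (h0 n x)).trans_le (h1 n x))
  suffices hsum : Integrable (fun x => g x + |f x|) μ from
    (hsum.sub hf.abs).congr (Eventually.of_forall fun x => add_sub_cancel_right (g x) |f x|)
  refine integrable_of_tendsto_of_integral_le (G := fun n x => χ n x * g x + χ n x * |f x|)
    (C := C + ∫ x, |f x| ∂μ) (fun n => (hg n).add (hχf n)) (fun n => ?_) (fun n => ?_)
    (Eventually.of_forall fun x => ?_)
  · filter_upwards [hfg] with x hx
    rw [Pi.zero_apply, ← mul_add]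
    exact mul_nonneg (h0 n x) (by linarith)
  · rw [integral_add (hg n) (hχf n)]
    gcongr
    · exact hC n
    · exact hχf n
    · exact hf.abs
    · exact fun x => mul_le_of_le_one_left (abs_nonneg _) (h1 n x)
  · simpa only [← mul_add, one_mul] using (hχ x).mul_const (g x + |f x|)

end Exhaustion

section Cutoff

/-- A sequence of smooth cutoffs `χ (x / (n + 1))` exhausting `ℝᵈ`, where `χ = 1` on the unit ball
and `χ = 0` off the ball of radius `2`. -/
noncomputable def cutoff (d n : ℕ) (x : Eucl d) : ℝ :=
  (⟨1, 2, one_pos, one_lt_two⟩ : ContDiffBump (0 : Eucl d)) (((n : ℝ) + 1)⁻¹ • x)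

variable {d : ℕ}

theorem continuous_cutoff (n : ℕ) : Continuous (cutoff d n) :=
  (ContDiffBump.continuous _).comp (continuous_const_smul _)

theorem hasCompactSupport_cutoff (n : ℕ) : HasCompactSupport (cutoff d n) :=
  hasCompactSupport_comp_inv_smul (ContDiffBump.hasCompactSupport _) (by positivity)

theorem cutoff_nonneg (n : ℕ) (x : Eucl d) : 0 ≤ cutoff d n x := ContDiffBump.nonneg _

theorem cutoff_le_one (n : ℕ) (x : Eucl d) : cutoff d n x ≤ 1 := ContDiffBump.le_one _

theorem tendsto_cutoff (x : Eucl d) : Tendsto (fun n => cutoff d n x) atTop (𝓝 1) := by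
  obtain ⟨N, hN⟩ := exists_nat_ge ‖x‖
  refine tendsto_const_nhds.congr' ?_
  filter_upwards [eventually_ge_atTop N] with n hn
  have hNn : (N : ℝ) ≤ n := Nat.cast_le.2 hn
  refine (ContDiffBump.one_of_mem_closedBall _ ?_).symm
  rw [mem_closedBall_zero_iff, norm_smul, Real.norm_of_nonneg (by positivity),
    inv_mul_le_iff₀ (by positivity)]
  linarith

theorem tendsto_integral_cutoff_smul {F : Type*} [NormedAddCommGroup F] [NormedSpace ℝ F]
    {f : Eucl d → F} (hf : Integrable f) :
    Tendsto (fun n => ∫ x, cutoff d n x • f x) atTop (𝓝 (∫ x, f x)) :=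
  tendsto_integral_smul_of_tendsto_one (fun n => (continuous_cutoff n).aestronglyMeasurable)
    cutoff_nonneg cutoff_le_one tendsto_cutoff hf

end Cutoff

section HomSobolev

variable {d : ℕ} {s : ℝ} [hs : Fact (0 < s ∧ s < (d : ℝ) / 2)]

include hs in
theorem two_mul_lt_finrank_eucl : 2 * s < Module.finrank ℝ (Eucl d) := by
  rw [finrank_euclideanSpace_fin]
  linarith [hs.out.2]

namespace HomSobolev

theorem ofReal_sq_norm_eq_homEnergy {u : HomSobolev d s} {g : Eucl d → ℂ}
    (hg : IsFourierTransformOf u g) :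
    ENNReal.ofReal (‖u‖ ^ 2) = homEnergy s (fun ξ => ‖g ξ‖ₑ) volume := by
  rw [norm_def, Real.sq_sqrt (integral_nonneg fun ξ => by positivity),
    ofReal_integral_eq_lintegral_ofReal u.integrable_fourier
      (Eventually.of_forall fun ξ => by positivity)]
  refine lintegral_congr_ae ?_
  filter_upwards [u.isFourierTransformOf_fourier.ae_eq hg ae_eq_rfl] with ξ hξ
  rw [hξ, enorm_weight_sq hs.out.1.le]

/-- The element of `H̊ˢ(ℝᵈ)` given by a function and its Fourier transform. -/
noncomputable def ofFunction {v : Eucl d → ℝ} {g : Eucl d → ℂ}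
    (hv : MemLp v (sobolevExponent d s) volume) (hg : IsFourierTransformOf v g)
    (hfin : homEnergy s (fun ξ => ‖g ξ‖ₑ) volume < ⊤) : HomSobolev d s :=
  ⟨hv.toLp, g, hg.congr_ae hv.coeFn_toLp.symm,
    integrable_weight_sq hs.out.1.le hg.aestronglyMeasurable hfin⟩

theorem coe_ofFunction {v : Eucl d → ℝ} {g : Eucl d → ℂ}
    (hv : MemLp v (sobolevExponent d s) volume) (hg : IsFourierTransformOf v g)
    (hfin : homEnergy s (fun ξ => ‖g ξ‖ₑ) volume < ⊤) :
    ⇑(ofFunction hv hg hfin : HomSobolev d s) =ᵐ[volume] v := hv.coeFn_toLp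

theorem ofReal_sq_norm_ofFunction {v : Eucl d → ℝ} {g : Eucl d → ℂ}
    (hv : MemLp v (sobolevExponent d s) volume) (hg : IsFourierTransformOf v g)
    (hfin : homEnergy s (fun ξ => ‖g ξ‖ₑ) volume < ⊤) :
    ENNReal.ofReal (‖(ofFunction hv hg hfin : HomSobolev d s)‖ ^ 2) =
      homEnergy s (fun ξ => ‖g ξ‖ₑ) volume :=
  ofReal_sq_norm_eq_homEnergy (hg.congr_ae (coe_ofFunction hv hg hfin).symm)

theorem exists_eq_mul_and_sq_norm_le {θ : Eucl d → ℝ} (hθ : ContDiff ℝ ∞ θ)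
    (hc : HasCompactSupport θ) (u : HomSobolev d s) {C : ℝ≥0∞} (hC : C ≠ ⊤)
    (hbound : ∀ G : Eucl d → ℝ≥0∞, Measurable G →
      homEnergy s ((fun ξ => ‖𝓕 (complexSchwartz hθ hc) ξ‖ₑ) ⋆ₗ[volume] G) volume ≤
        C * homEnergy s G volume) :
    ∃ w : HomSobolev d s, ⇑w =ᵐ[volume] (fun x => θ x * u x) ∧
      ‖w‖ ^ 2 ≤ C.toReal * ‖u‖ ^ 2 := by
  set K : 𝓢(Eucl d, ℂ) := 𝓕 (complexSchwartz hθ hc)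
  have hu := u.isFourierTransformOf_fourier
  set g := hu.aestronglyMeasurable.mk u.fourier
  have hgm : Measurable fun ξ => ‖g ξ‖ₑ :=
    hu.aestronglyMeasurable.stronglyMeasurable_mk.measurable.enorm
  have hug : IsFourierTransformOf u g := hu.congr_right hu.aestronglyMeasurable.ae_eq_mk
  have henergy := hbound _ hgm
  rw [← ofReal_sq_norm_eq_homEnergy hug] at henergy
  have hfin : C * ENNReal.ofReal (‖u‖ ^ 2) < ⊤ := by finiteness
  have hconv := measurable_lconvolution volume K.continuous.measurable.enorm hgm
  have hw : IsFourierTransformOf (fun x => θ x * u x) _ :=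
    hug.mul (Θ := complexSchwartz hθ hc) (fun x => rfl) fun φ =>
      lintegral_enorm_schwartz_mul_lt_top φ hs.out.1.le two_mul_lt_finrank_eucl
        hconv.aemeasurable (henergy.trans_lt hfin)
  have henergy_w := (homEnergy_mono fun ξ =>
    enorm_convolution_le (ContinuousLinearMap.opNorm_mul_le ℂ ℂ) K g ξ).trans henergy
  obtain ⟨M, hM⟩ := hc.exists_bound_of_continuous hθ.continuous
  have hwL : MemLp (fun x => θ x * u x) (sobolevExponent d s) volume :=
    u.memLp.of_le_mul (hθ.continuous.aestronglyMeasurable.mul u.memLp.1)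
      (Eventually.of_forall fun x => by
        rw [norm_mul]
        exact mul_le_mul_of_nonneg_right (hM x) (norm_nonneg _))
  refine ⟨ofFunction hwL hw (henergy_w.trans_lt hfin), coe_ofFunction _ _ _, ?_⟩
  rw [← ofReal_sq_norm_ofFunction hwL hw] at henergy_w
  simpa [ENNReal.toReal_mul, ENNReal.toReal_ofReal (sq_nonneg _)] using
    ENNReal.toReal_mono hfin.ne henergy_w

theorem exists_eq_comp_inv_smul_mul_and_sq_norm_le {θ : Eucl d → ℝ} (hθ : ContDiff ℝ ∞ θ)
    (hc : HasCompactSupport θ) : ∃ C : ℝ, ∀ (u : HomSobolev d s) (R : ℝ), 0 < R →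
      ∃ w : HomSobolev d s, ⇑w =ᵐ[volume] (fun x => θ (R⁻¹ • x) * u x) ∧
        ‖w‖ ^ 2 ≤ C * ‖u‖ ^ 2 := by
  let K : 𝓢(Eucl d, ℂ) := 𝓕 (complexSchwartz hθ hc)
  obtain ⟨C, hC, hdil⟩ := exists_homEnergy_dilation_lconvolution_le (μ := volume) hs.out.1.le
    two_mul_lt_finrank_eucl K.continuous.measurable.enorm K.integrable.2.ne
    (lintegral_enorm_rpow_mul_enorm_schwartz_lt_top K hs.out.1.le).ne
    (homEnergy_schwartz_lt_top K hs.out.1.le).ne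
  refine ⟨C.toReal, fun u R hR => exists_eq_mul_and_sq_norm_le (contDiff_comp_inv_smul hθ R)
    (hasCompactSupport_comp_inv_smul hc hR) u hC fun G hG => ?_⟩
  have kernel (ξ : Eucl d) : ‖𝓕 (complexSchwartz (contDiff_comp_inv_smul hθ R)
      (hasCompactSupport_comp_inv_smul hc hR)) ξ‖ₑ =
        ENNReal.ofReal |R ^ Module.finrank ℝ (Eucl d)| * ‖K (R • ξ)‖ₑ := by
    rw [fourier_complexSchwartz_comp_inv_smul hθ hc hR, enorm_smul, finrank_euclideanSpace_fin,
      Real.enorm_eq_ofReal_abs]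
  rw [funext kernel]
  exact hdil G hG R hR.ne'

variable (d s) in
/-- The isometric embedding `u ↦ |ξ|^s û` of `H̊ˢ(ℝᵈ)` into `L²(ℝᵈ)`. -/
noncomputable def weightL2 : HomSobolev d s →ₗᵢ[ℝ] Lp ℂ 2 (volume : Measure (Eucl d)) where
  toFun u := u.memLp_weight.toLp
  map_add' u v := by
    rw [← MemLp.toLp_add]
    refine (MemLp.toLp_eq_toLp_iff _ _).2 ((fourier_add u v).mono fun ξ hξ => ?_)
    simp only [hξ, Pi.add_apply, smul_add]
  map_smul' c u := by
    rw [RingHom.id_apply, ← MemLp.toLp_const_smul]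
    refine (MemLp.toLp_eq_toLp_iff _ _).2 ((fourier_smul c u).mono fun ξ hξ => ?_)
    simp only [hξ, Pi.smul_apply]
    rw [smul_comm]
  norm_map' u := u.norm_eq_toLp.symm

theorem coeFn_weightL2 (u : HomSobolev d s) :
    weightL2 d s u =ᵐ[volume] fun ξ => (‖ξ‖ ^ s : ℝ) • u.fourier ξ :=
  u.memLp_weight.coeFn_toLp

theorem inner_weightL2 {φ : Eucl d → ℝ} (hφ : ContDiff ℝ ∞ φ) (hc : HasCompactSupport φ)
    (h0 : tsupport φ ⊆ {0}ᶜ) (u : HomSobolev d s) :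
    inner ℂ ((complexSchwartz hφ hc).memLp 2 volume).toLp (weightL2 d s u) =
      ∫ x, (u x : ℂ) * 𝓕 (complexSchwartz (contDiff_norm_rpow_mul s hφ h0) hc.mul_left) x := by
  rw [u.isFourierTransformOf_fourier.integral_eq, L2.inner_def]
  refine integral_congr_ae ?_
  filter_upwards [((complexSchwartz hφ hc).memLp 2 volume).coeFn_toLp, coeFn_weightL2 u]
    with ξ hφξ huξ
  rw [hφξ, huξ]
  simp only [complexSchwartz_apply, RCLike.inner_apply, Complex.conj_ofReal, Complex.real_smul,
    Complex.ofReal_mul]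
  ring

theorem exists_dual_eq_re_inner_weightL2 (Λ : HomSobolevDual d s) :
    ∃ w : Lp ℂ 2 (volume : Measure (Eucl d)), ∀ u, Λ u = (inner ℂ w (weightL2 d s u)).re := by
  let e := (weightL2 d s).equivRange
  obtain ⟨F, hF, -⟩ := exists_extension_norm_eq (𝕜 := ℝ)
    (LinearMap.range (weightL2 d s).toLinearMap)
    (Λ ∘L (e.symm.toContinuousLinearEquiv : _ →L[ℝ] HomSobolev d s))
  refine ⟨(InnerProductSpace.toDual ℂ _).symm F.extendRCLike, fun u => ?_⟩
  have extend_re : (F.extendRCLike (𝕜 := ℂ) (weightL2 d s u)).re = F (weightL2 d s u) := by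
    simp [StrongDual.extendRCLike_apply]
  rw [InnerProductSpace.toDual_symm_apply, extend_re]
  refine (?_ : Λ u = _).trans (hF (e u)).symm
  simp

theorem tendsto_dual_of_bounded (Λ : HomSobolevDual d s) {ι : Type*} {l : Filter ι}
    {w : ι → HomSobolev d s} {u : HomSobolev d s} {C : ℝ} (hw : ∀ i, ‖w i‖ ≤ C)
    (h : ∀ φ : 𝓢(Eucl d, ℂ),
      Tendsto (fun i => ∫ x, (w i x : ℂ) * φ x) l (𝓝 (∫ x, (u x : ℂ) * φ x))) :
    Tendsto (fun i => Λ (w i)) l (𝓝 (Λ u)) := by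
  have : Nontrivial (Eucl d) := Module.nontrivial_of_finrank_pos (R := ℝ) (by
    exact_mod_cast (mul_pos two_pos hs.out.1).trans two_mul_lt_finrank_eucl)
  obtain ⟨z, hz⟩ := exists_dual_eq_re_inner_weightL2 Λ
  have bounded (i : ι) : ‖weightL2 d s (w i - u)‖ ≤ (C + ‖u‖).toNNReal := by
    rw [LinearIsometry.norm_map]
    exact (norm_sub_le _ _).trans ((by gcongr; exact hw i : _ ≤ C + ‖u‖).trans
      (Real.le_coe_toNNReal _))
  have weak := tendsto_inner_zero_of_total (𝕜 := ℂ) (l := l) bounded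
    (D := {v | ∃ (φ : Eucl d → ℝ) (hφ : ContDiff ℝ ∞ φ) (hc : HasCompactSupport φ),
      tsupport φ ⊆ {0}ᶜ ∧ v = ((complexSchwartz hφ hc).memLp 2 volume).toLp})
    (fun v hv => eq_zero_of_inner_complexSchwartz_eq_zero fun φ hφ hc h0 =>
      hv _ ⟨φ, hφ, hc, h0, rfl⟩) ?_ z
  · rw [← tendsto_sub_nhds_zero_iff]
    refine ((Complex.continuous_re.tendsto _).comp weak).congr fun i => ?_
    rw [← map_sub, hz, Function.comp_apply]
  · rintro _ ⟨φ, hφ, hc, h0, rfl⟩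
    simp only [map_sub, inner_sub_right, inner_weightL2 hφ hc h0]
    rw [tendsto_sub_nhds_zero_iff]
    exact h _

end HomSobolev

end HomSobolev

section Duality

theorem mul_indicator_ae_eq_of_ae_eq_zero {α : Type*} [MeasurableSpace α] {μ : Measure α}
    {K : Set α} {v : α → ℝ} (hv : ∀ᵐ x ∂μ, x ∉ K → v x = 0) (T : α → ℝ) :
    (fun x => v x * K.indicator T x) =ᵐ[μ] fun x => T x * v x := by
  filter_upwards [hv] with x hx
  by_cases hxK : x ∈ K
  · rw [Set.indicator_of_mem hxK, mul_comm]
  · rw [hx hxK, zero_mul, mul_zero]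

theorem MemLpLocally.memLp_indicator {d : ℕ} {T : Eucl d → ℝ} {p q : ℝ≥0∞}
    (hT : MemLpLocally T q) (hpq : p ≤ q) {K : Set (Eucl d)} (hK : IsCompact K) :
    MemLp (K.indicator T) p volume := by
  have : IsFiniteMeasure (volume.restrict K) := isFiniteMeasure_restrict.2 hK.measure_lt_top.ne
  exact (memLp_indicator_iff_restrict hK.measurableSet).2 ((hT K hK).mono_exponent hpq)

namespace HomSobolev

variable {d : ℕ} {s : ℝ} [hs : Fact (0 < s ∧ s < (d : ℝ) / 2)]

variable (d s) in
theorem holderConjugate_sobolevExponent :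
    ENNReal.HolderConjugate (sobolevExponent d s) (ENNReal.ofReal (2 * d / (d + 2 * s))) := by
  obtain ⟨hs0, hsd⟩ := hs.out
  have hd : (0 : ℝ) < d := by linarith
  have hd' : 0 < d - 2 * s := by linarith
  have hconj : (2 * d / (d - 2 * s)).HolderConjugate (2 * d / (d + 2 * s)) := by
    refine Real.holderConjugate_iff.2 ⟨?_, ?_⟩
    · rw [lt_div_iff₀ hd']
      linarith
    · field_simp
      ring
  exact hconj.ennrealOfReal

theorem locallyIntegrable (v : HomSobolev d s) : LocallyIntegrable v volume :=
  v.memLp.locallyIntegrable (one_le_sobolevExponent d s hs.out)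

theorem integrable_of_compact (v : HomSobolev d s) {K : Set (Eucl d)} (hK : IsCompact K)
    (hv : ∀ᵐ x, x ∉ K → v x = 0) : Integrable v volume :=
  (v.locallyIntegrable.integrableOn_isCompact hK).integrable_of_ae_notMem_eq_zero hv

theorem norm_ofTestFunction_mollify_le {v : HomSobolev d s} (hv : Integrable v volume)
    (φ : ContDiffBump (0 : Eucl d)) (hc : HasCompactSupport (mollify φ volume v)) :
    ‖(ofTestFunction (mollify φ volume v) (contDiff_mollify φ v.locallyIntegrable) hc :
      HomSobolev d s)‖ ≤ ‖v‖ := by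
  set w : HomSobolev d s := ofTestFunction _ (contDiff_mollify φ v.locallyIntegrable) hc
  have hw : ⇑w =ᵐ[volume] mollify φ volume v := coe_ofTestFunction _ _ _
  have hcoe : (fun x => ((mollify φ volume v x : ℝ) : ℂ)) =
      mollify φ volume fun x => (v x : ℂ) := by
    ext x
    simp [mollify, convolution_def, ← integral_complex_ofReal]
  have hvF : IsFourierTransformOf v (𝓕 fun x => (v x : ℂ)) := .of_integrable hv
  have hwF : IsFourierTransformOf w (𝓕 (mollify φ volume fun x => (v x : ℂ))) := by
    rw [← hcoe]
    exact (IsFourierTransformOf.of_integrable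
      ((contDiff_mollify φ v.locallyIntegrable).continuous.integrable_of_hasCompactSupport
        hc)).congr_ae hw.symm
  refine (sq_le_sq₀ (norm_nonneg _) (norm_nonneg _)).1
    ((ENNReal.ofReal_le_ofReal_iff (sq_nonneg _)).1 ?_)
  rw [ofReal_sq_norm_eq_homEnergy hwF, ofReal_sq_norm_eq_homEnergy hvF]
  exact homEnergy_mono fun ξ =>
    enorm_le_iff_norm_le.2 (norm_fourier_mollify_le φ hv.ofReal ξ)

section CompactSupport

variable (v : HomSobolev d s) {K : Set (Eucl d)} (hK : IsCompact K)
  (hv : ∀ᵐ x, x ∉ K → v x = 0) {ι : Type*} {l : Filter ι} {φ : ι → ContDiffBump (0 : Eucl d)}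
  (hφ : Tendsto (fun i => (φ i).rOut) l (𝓝 0))

include hφ in
theorem tendsto_dual_ofTestFunction_mollify (Λ : HomSobolevDual d s) :
    Tendsto (fun i => Λ (ofTestFunction (mollify (φ i) volume v)
      (contDiff_mollify _ v.locallyIntegrable) (hasCompactSupport_mollify _ hK hv))) l
      (𝓝 (Λ v)) := by
  have := holderConjugate_sobolevExponent d s
  refine tendsto_dual_of_bounded Λ (fun i =>
    norm_ofTestFunction_mollify_le (v.integrable_of_compact hK hv) (φ i) _) fun ψ => ?_
  have hlim := tendsto_integral_mollify_smul hφ (p := sobolevExponent d s) ENNReal.ofReal_ne_top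
    v.memLp (ψ.memLp (ENNReal.ofReal (2 * d / (d + 2 * s))) volume)
  simp only [Complex.real_smul] at hlim
  exact hlim.congr fun i => integral_congr_ae
    ((coe_ofTestFunction (mollify (φ i) volume v) _ _).mono fun x hx =>
      congrArg (fun y : ℝ => (y : ℂ) * ψ x) hx.symm)

variable {q : ℝ≥0∞} (hq : ENNReal.ofReal (2 * d / (d + 2 * s)) ≤ q) {T : Eucl d → ℝ}
  (hT : MemLpLocally T q)

include hK hv hq hT in
theorem integrable_mul_of_compact : Integrable (fun x => T x * v x) volume := by
  have := (holderConjugate_sobolevExponent d s).symm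
  exact (memLp_one_iff_integrable.1 ((hT.memLp_indicator hq hK).mul v.memLp)).congr
    (mul_indicator_ae_eq_of_ae_eq_zero hv T)

include hφ hK hv hq hT in
theorem tendsto_integral_mul_mollify (hφ1 : ∀ i, (φ i).rOut ≤ 1) :
    Tendsto (fun i => ∫ x, T x * mollify (φ i) volume v x) l (𝓝 (∫ x, T x * v x)) := by
  have := holderConjugate_sobolevExponent d s
  have hlim := tendsto_integral_mollify_smul hφ (p := sobolevExponent d s) ENNReal.ofReal_ne_top
    v.memLp (hT.memLp_indicator hq (hK.cthickening (r := 1)))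
  have hv' : ∀ᵐ x, x ∉ Metric.cthickening 1 K → v x = 0 :=
    hv.mono fun x hx hxK => hx fun h => hxK (Metric.self_subset_cthickening K h)
  have hmollify (i : ι) : ∀ x ∉ Metric.cthickening 1 K, mollify (φ i) volume v x = 0 :=
    fun x hx => Function.notMem_support.1 fun h =>
      hx (Metric.cthickening_mono (hφ1 i) K (support_mollify_subset _ hv h))
  simp only [smul_eq_mul] at hlim
  rw [integral_congr_ae (mul_indicator_ae_eq_of_ae_eq_zero hv' T)] at hlim
  exact hlim.congr fun i => integral_congr_ae
    (mul_indicator_ae_eq_of_ae_eq_zero (Eventually.of_forall (hmollify i)) T)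

include hK hv hq hT in
theorem dual_eq_integral_of_compact {Λ : HomSobolevDual d s} (hΛ : Λ.IsRegular T) :
    Λ v = ∫ x, T x * v x := by
  obtain ⟨φ, hφ1, hφ⟩ := exists_seq_contDiffBump_tendsto_rOut_zero (Eucl d)
  refine tendsto_nhds_unique (tendsto_dual_ofTestFunction_mollify v hK hv hφ Λ) ?_
  simp only [hΛ _ (contDiff_mollify _ v.locallyIntegrable) (hasCompactSupport_mollify _ hK hv)]
  exact tendsto_integral_mul_mollify v hK hv hφ hq hT hφ1

end CompactSupport

section Cutoff

theorem exists_bounded_ae_eq_cutoff_mul (u : HomSobolev d s) :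
    ∃ (C : ℝ) (w : ℕ → HomSobolev d s), (∀ n, ‖w n‖ ≤ C) ∧
      ∀ n, w n =ᵐ[volume] fun x => cutoff d n x * u x := by
  let χ : ContDiffBump (0 : Eucl d) := ⟨1, 2, one_pos, one_lt_two⟩
  obtain ⟨C, hC⟩ := exists_eq_comp_inv_smul_mul_and_sq_norm_le (s := s) χ.contDiff
    χ.hasCompactSupport
  choose w hw hwC using fun n : ℕ => hC u ((n : ℝ) + 1) (by positivity)
  exact ⟨√(C * ‖u‖ ^ 2), w, fun n => Real.le_sqrt_of_sq_le (hwC n), hw⟩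

variable {u : HomSobolev d s} {w : ℕ → HomSobolev d s}

theorem tendsto_dual_cutoff_mul (Λ : HomSobolevDual d s) {C : ℝ} (hC : ∀ n, ‖w n‖ ≤ C)
    (hw : ∀ n, w n =ᵐ[volume] fun x => cutoff d n x * u x) :
    Tendsto (fun n => Λ (w n)) atTop (𝓝 (Λ u)) := by
  refine tendsto_dual_of_bounded Λ hC fun φ => ?_
  have hlim := tendsto_integral_cutoff_smul (IsFourierTransformOf.integrable_mul_schwartz
    (one_le_sobolevExponent d s hs.out) u.memLp φ)
  refine hlim.congr fun n => integral_congr_ae ((hw n).mono fun x hx => ?_)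
  simp only [hx, Complex.real_smul, Complex.ofReal_mul, mul_assoc]

theorem dual_eq_integral_cutoff_mul {q : ℝ≥0∞} (hq : ENNReal.ofReal (2 * d / (d + 2 * s)) ≤ q)
    {T : Eucl d → ℝ} (hT : MemLpLocally T q) {Λ : HomSobolevDual d s} (hΛ : Λ.IsRegular T)
    {v : HomSobolev d s} {n : ℕ} (hv : v =ᵐ[volume] fun x => cutoff d n x * u x) :
    Integrable (fun x => cutoff d n x * (T x * u x)) volume ∧
      Λ v = ∫ x, cutoff d n x * (T x * u x) := by
  have hK : IsCompact (tsupport (cutoff d n)) := (hasCompactSupport_cutoff n).isCompact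
  have hvK : ∀ᵐ x, x ∉ tsupport (cutoff d n) → v x = 0 := hv.mono fun x hx hxK =>
    hx.trans (mul_eq_zero_of_left (image_eq_zero_of_notMem_tsupport hxK) _)
  have hTv : (fun x => T x * v x) =ᵐ[volume] fun x => cutoff d n x * (T x * u x) :=
    hv.mono fun x hx => by simp only [hx, mul_left_comm]
  exact ⟨(integrable_mul_of_compact v hK hvK hq hT).congr hTv,
    (dual_eq_integral_of_compact v hK hvK hq hT hΛ).trans (integral_congr_ae hTv)⟩

end Cutoff

end HomSobolev

end Duality

open HomSobolev in
theorem theorem4p3_general (d : ℕ) (s : ℝ) [hs : Fact (0 < s ∧ s < (d : ℝ) / 2)]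
    (q : ℝ≥0∞) (hq : ENNReal.ofReal (2 * d / (d + 2 * s)) ≤ q)
    (T : Eucl d → ℝ) (hT : MemLpLocally T q)
    (Λ : HomSobolevDual d s) (hΛ : Λ.IsRegular T)
    (u : HomSobolev d s) (f : Eucl d → ℝ) (hf : Integrable f volume)
    (hTu : ∀ᵐ x, T x * u x ≥ -|f x|) :
    Integrable (fun x => T x * u x) volume ∧ Λ u = ∫ x, T x * u x := by
  obtain ⟨C, w, hC, hw⟩ := exists_bounded_ae_eq_cutoff_mul u
  have hΛw (n : ℕ) := dual_eq_integral_cutoff_mul hq hT hΛ (hw n)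
  have hint : Integrable (fun x => T x * u x) volume := by
    refine integrable_of_neg_abs_le_of_integral_mul_le
      (fun n => (continuous_cutoff n).aestronglyMeasurable) cutoff_nonneg cutoff_le_one
      tendsto_cutoff hf hTu (fun n => (hΛw n).1) (C := ‖Λ‖ * C) fun n => ?_
    rw [← (hΛw n).2]
    exact (le_abs_self _).trans (Λ.le_opNorm_of_le (hC n))
  refine ⟨hint, tendsto_nhds_unique (tendsto_dual_cutoff_mul Λ hC hw) ?_⟩
  simp only [fun n => (hΛw n).2]
  exact tendsto_integral_cutoff_smul hint

theorem theorem4p3 (d : ℕ) (hd : 2 ≤ d) (s : ℝ) [hs : Fact (0 < s ∧ s < (d : ℝ) / 2)]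
    (q : ℝ≥0∞) (hq : ENNReal.ofReal (2 * d / (d + 2 * s)) ≤ q)
    (T : Eucl d → ℝ) (hT : MemLpLocally T q)
    (Λ : HomSobolevDual d s) (hΛ : Λ.IsRegular T)
    (u : HomSobolev d s) (f : Eucl d → ℝ) (hf : Integrable f volume)
    (hTu : ∀ᵐ x, T x * u x ≥ -|f x|) :
    Integrable (fun x => T x * u x) volume ∧ Λ u = ∫ x, T x * u x :=
  theorem4p3_general d s q hq T hT Λ hΛ u f hf hTu
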